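/- Let $a,A\in W^{1,\infty}(\mathbb S^1,\mathbb R)$, where functions on $\mathbb S^1$ are identified with $2\pi$-periodic functions of $\theta\in\mathbb R$, and let $$\widetilde a=\frac1{2\pi}\int_0^{2\pi}a(s)\,ds,\qquad \widetilde A=\frac1{2\pi}\int_0^{2\pi}A(s)\,ds .$$ Assume that $\widetilde A\in\frac12\mathbb Z\setminus\mathbb Z$. Let $L_{\mathbf A,a}$ be the operator $$L_{\mathbf A,a}\varphi=\Big(-i\frac{d}{d\theta}+A(\theta)\Big)^2\varphi+a(\theta)\varphi$$ in $L^2(\mathbb S^1,\mathbb C)$ with domain $H^2(\mathbb S^1,\mathbb C)$. Its eigenvalues, repeated according to their finite multiplicities, form a real sequence $\mu_1\le\mu_2\le\cdots$ with $\mu_k\to+\infty$, and the following holds. There exist $k^*,\ell\in\mathbb N$, $\ell\ge1$, and real numbers $\lambda_j$ ($j\in\mathbb Z$, $|j|\ge\ell$) such that the families $\{\mu_k: k>k^*\}$ and $\{\lambda_j: j\in\mathbb Z,\ |j|\ge\ell\}$ coincide, counted with multiplicity (that is, $\lambda_j=\mu_{\sigma(j)}$ for a bijection $\sigma$ from $\{j\in\mathbb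 Z:|j|\ge\ell\}$ onto $\{k: k>k^*\}$), and $$\lambda_j=\widetilde a+\Big(j+\frac12\Big)^2+O\Big(\frac1{|j|}\Big)\qquad\text{as }|j|\to+\infty .$$ Furthermore, for every $j\in\mathbb Z$ with $|j|\ge\ell$ there exist $\theta_j\in[0,2\pi]$ and an eigenfunction $\phi_j$ of $L_{\mathbf A,a}$ corresponding to the eigenvalue $\lambda_j$, normalized by $\int_0^{2\pi}|\phi_j(\theta)|^2\,d\theta=1$, such that for $\theta\in[0,2\pi]$ $$\phi_j(\theta)=\frac1{\sqrt\pi}\,e^{-i\int_0^\theta A(t)\,dt}\Big(\cos\big((j+\tfrac12)(\theta-\theta_j)\big)+R_j(\theta)\Big),$$ where $\|R_j\|_{L^\infty(0,2\pi)}=O\big(\frac1{|j|}\big)$ as $|j|\to+\infty$. -/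

import Mathlib

open MeasureTheory Filter

noncomputable section

/-! Functions on the unit circle are identified with `2π`-periodic functions of the angle, with
arc length `dθ` on one period. -/

namespace CircleMagnetic

/-- Arc length measure on one period of the circle. -/
def arc : Measure ℝ := volume.restrict (Set.Ioc 0 (2 * Real.pi))

instance : IsFiniteMeasure arc := by unfold arc; infer_instance

/-- `g` is a weak derivative of `f` on the circle: the test functions are the smooth
`2π`-periodic functions. -/
def HasWeakDeriv (f g : ℝ → ℂ) : Prop :=
  ∀ η : ℝ → ℂ, ContDiff ℝ (⊤ : ℕ∞) η → Function.Periodic η (2 * Real.pi) →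
    ∫ θ, f θ * deriv η θ ∂arc = -∫ θ, g θ * η θ ∂arc

/-- `f ∈ W^{1,∞}(𝕊¹, ℝ)`. -/
structure MemW1Infty (f : ℝ → ℝ) : Prop where
  periodic : Function.Periodic f (2 * Real.pi)
  memLp : MemLp f ⊤ arc
  weakDeriv : ∃ g : ℝ → ℝ, MemLp g ⊤ arc ∧
    HasWeakDeriv (fun θ => (f θ : ℂ)) (fun θ => (g θ : ℂ))

/-- `f ∈ H¹(𝕊¹, ℂ)` with weak derivative `g ∈ L²(𝕊¹, ℂ)`. -/
structure HasH1Deriv (f g : ℝ → ℂ) : Prop where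
  memLp : MemLp f 2 arc
  memLp_deriv : MemLp g 2 arc
  weakDeriv : HasWeakDeriv f g

/-- The mean value `(2π)⁻¹ ∫₀^{2π} f`. -/
def circleMean (f : ℝ → ℝ) : ℝ := (1 / (2 * Real.pi)) * ∫ s in (0 : ℝ)..(2 * Real.pi), f s

/-- `φ ∈ H¹(𝕊¹, ℂ)` and `(-i d/dθ + A) φ = ψ` almost everywhere. -/
def MagneticDeriv (A : ℝ → ℝ) (φ ψ : ℝ → ℂ) : Prop :=
  ∃ g : ℝ → ℂ, HasH1Deriv φ g ∧ ∀ᵐ θ ∂arc, ψ θ = -Complex.I * g θ + (A θ : ℂ) * φ θ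

/-- `φ` is in the domain of `L = (-i d/dθ + A)² + a`, i.e. `φ` and `(-i d/dθ + A) φ` are in
`H¹(𝕊¹, ℂ)` (for `A ∈ W^{1,∞}` this says `φ ∈ H²(𝕊¹, ℂ)`), and `L φ = f` almost everywhere. -/
def MagneticSchrodinger (A a : ℝ → ℝ) (φ f : ℝ → ℂ) : Prop :=
  ∃ ψ χ : ℝ → ℂ, MagneticDeriv A φ ψ ∧ MagneticDeriv A ψ χ ∧
    ∀ᵐ θ ∂arc, f θ = χ θ + (a θ : ℂ) * φ θ

theorem HasWeakDeriv.integrable_mul {f η : ℝ → ℂ} (hf : MemLp f 2 arc) (hη : Continuous η) :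
    Integrable (fun θ => f θ * η θ) arc := by
  have h1 : Integrable f arc := hf.integrable (by norm_num)
  obtain ⟨C, hC⟩ := (isCompact_Icc (a := (0 : ℝ)) (b := 2 * Real.pi)).exists_bound_of_continuousOn
    hη.continuousOn
  refine h1.mul_bdd (c := C) hη.aestronglyMeasurable ?_
  refine (ae_restrict_iff' measurableSet_Ioc).2 (ae_of_all _ fun θ hθ => ?_)
  exact hC θ (Set.Ioc_subset_Icc_self hθ)

theorem HasH1Deriv.zero : HasH1Deriv (fun _ => 0) (fun _ => 0) :=
  ⟨MemLp.zero, MemLp.zero, fun η _ _ => by simp⟩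

theorem HasH1Deriv.add {f g f' g' : ℝ → ℂ} (h : HasH1Deriv f f') (k : HasH1Deriv g g') :
    HasH1Deriv (fun θ => f θ + g θ) (fun θ => f' θ + g' θ) := by
  refine ⟨h.memLp.add k.memLp, h.memLp_deriv.add k.memLp_deriv, fun η hη hp => ?_⟩
  have hd : Continuous (deriv η) := hη.continuous_deriv (by simp)
  simp only [add_mul]
  rw [integral_add (HasWeakDeriv.integrable_mul h.memLp hd)
      (HasWeakDeriv.integrable_mul k.memLp hd),
    integral_add (HasWeakDeriv.integrable_mul h.memLp_deriv hη.continuous)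
      (HasWeakDeriv.integrable_mul k.memLp_deriv hη.continuous),
    h.weakDeriv η hη hp, k.weakDeriv η hη hp]
  ring

theorem HasH1Deriv.const_mul {f f' : ℝ → ℂ} (c : ℂ) (h : HasH1Deriv f f') :
    HasH1Deriv (fun θ => c * f θ) (fun θ => c * f' θ) := by
  refine ⟨h.memLp.const_mul c, h.memLp_deriv.const_mul c, fun η hη hp => ?_⟩
  simp only [mul_assoc]
  rw [integral_const_mul, integral_const_mul, h.weakDeriv η hη hp]
  ring

theorem MagneticDeriv.zero (A : ℝ → ℝ) : MagneticDeriv A (fun _ => 0) (fun _ => 0) :=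
  ⟨fun _ => 0, HasH1Deriv.zero, ae_of_all _ fun θ => by simp⟩

theorem MagneticDeriv.add {A : ℝ → ℝ} {φ ψ φ' ψ' : ℝ → ℂ} (h : MagneticDeriv A φ ψ)
    (k : MagneticDeriv A φ' ψ') :
    MagneticDeriv A (fun θ => φ θ + φ' θ) (fun θ => ψ θ + ψ' θ) := by
  obtain ⟨g, hg, e⟩ := h
  obtain ⟨g', hg', e'⟩ := k
  refine ⟨_, hg.add hg', ?_⟩
  filter_upwards [e, e'] with θ h1 h2
  rw [h1, h2]
  ring

theorem MagneticDeriv.const_mul {A : ℝ → ℝ} {φ ψ : ℝ → ℂ} (c : ℂ) (h : MagneticDeriv A φ ψ) :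
    MagneticDeriv A (fun θ => c * φ θ) (fun θ => c * ψ θ) := by
  obtain ⟨g, hg, e⟩ := h
  refine ⟨_, hg.const_mul c, ?_⟩
  filter_upwards [e] with θ h1
  rw [h1]
  ring

/-- The eigenspace `ker (L - z)` of `L = (-i d/dθ + A)² + a`. Elements of the domain of `L` are
represented by their (unique) continuous `2π`-periodic representatives. -/
def eigenspace (A a : ℝ → ℝ) (z : ℂ) : Submodule ℂ (ℝ → ℂ) where
  carrier := {φ | Continuous φ ∧ Function.Periodic φ (2 * Real.pi) ∧
    MagneticSchrodinger A a φ (fun θ => z * φ θ)}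
  zero_mem' := by
    refine ⟨continuous_const, fun _ => rfl, fun _ => 0, fun _ => 0, ?_, ?_, ?_⟩
    · exact MagneticDeriv.zero A
    · exact MagneticDeriv.zero A
    · exact ae_of_all _ fun θ => by simp
  add_mem' := by
    rintro φ φ' ⟨hc, hp, ψ, χ, h1, h2, h3⟩ ⟨hc', hp', ψ', χ', h1', h2', h3'⟩
    refine ⟨hc.add hc', hp.add hp', _, _, h1.add h1', h2.add h2', ?_⟩
    filter_upwards [h3, h3'] with θ e e'
    simp only [Pi.add_apply, mul_add, e, e']
    ring
  smul_mem' := by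
    rintro c φ ⟨hc, hp, ψ, χ, h1, h2, h3⟩
    refine ⟨hc.const_smul c, fun θ => by simp [hp θ], _, _, h1.const_mul c, h2.const_mul c, ?_⟩
    filter_upwards [h3] with θ e
    simp only [Pi.smul_apply, smul_eq_mul]
    linear_combination c * e

/-- `μ₁ ≤ μ₂ ≤ ⋯ → +∞` is the sequence of all eigenvalues of `L = (-i d/dθ + A)² + a`, each
repeated according to its (finite) multiplicity. -/
structure IsEigenvalueSequence (A a : ℝ → ℝ) (μ : ℕ+ → ℝ) : Prop where
  mono : Monotone μ
  tendsto : Tendsto μ atTop atTop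
  finite_mult : ∀ z : ℂ, FiniteDimensional ℂ (eigenspace A a z)
  count : ∀ z : ℂ, {k : ℕ+ | (μ k : ℂ) = z}.ncard = Module.finrank ℂ (eigenspace A a z)

end CircleMagnetic

end

/-! Because the mean of `A` is a half-integer, the functions `(2π)^{-1/2} exp(i((m + 1/2)θ - ∫₀^θ
A))`, `m ∈ ℤ`, are periodic. They form a Hilbert basis of `L²` and are eigenfunctions of `-i d/dθ +
A` with eigenvalues `m + 1/2`. In this basis the operator is `D + V`, where `D` is diagonal with
entries `(m + 1/2)²` and `V` is the bounded symmetric multiplication by `a`. The modes `m` and `-1 -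
m` share an entry of `D`.

Eigenvalues: `D + V + s` has a compact inverse for large `s`, which gives an orthonormal eigenbasis.
A dimension count, used once for `D` against `D + V` and once in reverse
(`card_le_card_of_perturbation`), shows that for large `n` exactly two eigenvalues lie in `(n²,
(n+1)²]`; they are labelled `j = n` and `j = -1 - n`.

Eigenvectors: for `λ` in that window the equation `(d_m - λ) x_m = -(Vx)_m` and the gap between `λ`
and the other `d_m` make the coefficients outside the modes `n`, `-1 - n` have `ℓ¹` norm `O(1/n)`,
hence a uniformly small contribution. The antilinear map `f ↦ e^{-2i∫A} f̄` commutes with the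
operator, so an eigenvector with `x_{-1-n} = conj x_n` exists, and its two main modes add up to a
cosine. The `n`-th row of the equation then gives `λ`: the diagonal entry of `V` is the mean of `a`,
and the entry coupling `n` with `-1 - n` is a Fourier coefficient of `a` of frequency `2n + 1` in
modulus, which is `O(1/n)` since `a` has a bounded weak derivative. -/

noncomputable section

open scoped InnerProductSpace ComplexConjugate

/-! ### Hilbert bases: eigenvalue counting and diagonal operators. -/

namespace HilbertBasis

variable {ι κ H : Type*} [NormedAddCommGroup H] [InnerProductSpace ℂ H]

theorem hasSum_sq_norm_inner (b : HilbertBasis ι ℂ H) (x : H) :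
    HasSum (fun i => ‖⟪b i, x⟫_ℂ‖ ^ 2) (‖x‖ ^ 2) := by
  have h := b.hasSum_inner_mul_inner x x
  have h2 := (Complex.reCLM.hasSum h)
  convert! h2 using 1
  · ext i
    simp only [Complex.reCLM_apply]
    rw [← inner_conj_symm x (b i), RCLike.conj_mul]
    norm_cast
  · rw [← @inner_self_eq_norm_sq ℂ]
    rfl

theorem ext_inner (b : HilbertBasis ι ℂ H) {x y : H} (h : ∀ i, ⟪b i, x⟫_ℂ = ⟪b i, y⟫_ℂ) :
    x = y := by
  rw [← sub_eq_zero, ← norm_eq_zero, ← sq_eq_zero_iff,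
    ← (b.hasSum_sq_norm_inner (x - y)).tsum_eq]
  simp [h]

/-- If two Hilbert bases diagonalise operators with real eigenvalues `d` and `e` that differ by a
bounded operator `V`, then the number of `e`-eigenvalues within `r` of `c` is at most the number of
`d`-eigenvalues that are not further than `r + ‖V‖` from `c`. -/
theorem card_le_card_of_perturbation (b : HilbertBasis ι ℂ H) (u : HilbertBasis κ ℂ H)
    (d : ι → ℝ) (e : κ → ℝ) (V : H →L[ℂ] H)
    (h : ∀ m i, (d m : ℂ) * ⟪b m, u i⟫_ℂ + ⟪b m, V (u i)⟫_ℂ = e i * ⟪b m, u i⟫_ℂ)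
    {c r ρ : ℝ} (hρ : r + ‖V‖ < ρ) (hr : 0 ≤ r) (F : Finset κ) (hF : ∀ i ∈ F, |e i - c| ≤ r)
    (M : Finset ι) (hM : ∀ m ∉ M, ρ ≤ |d m - c|) : F.card ≤ M.card := by
  by_contra! hlt
  let f : (F → ℂ) →ₗ[ℂ] (M → ℂ) :=
    { toFun := fun x m => ⟪b m, ∑ i, x i • u i⟫_ℂ
      map_add' := fun x y => by
        ext m
        simp [add_smul, Finset.sum_add_distrib]
      map_smul' := fun a x => by
        ext m
        simp only [Pi.smul_apply, smul_eq_mul, mul_smul, ← Finset.smul_sum, inner_smul_right,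
          RingHom.id_apply] }
  -- More vectors `u i` than conditions: a nonzero combination `w` is orthogonal to all `b m` with
  -- `m ∈ M`.
  have hker : LinearMap.ker f ≠ ⊥ := by
    apply LinearMap.ker_ne_bot_of_finrank_lt
    simpa using hlt
  obtain ⟨x, hx, hx0⟩ := Submodule.exists_mem_ne_zero_of_ne_bot hker
  have hon : Orthonormal ℂ (fun i : F => u i) :=
    u.orthonormal.comp _ Subtype.coe_injective
  have hnorm : ∀ y : F → ℂ, ‖∑ i : F, y i • u (i : κ)‖ ^ 2 = ∑ i : F, ‖y i‖ ^ 2 := by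
    intro y
    rw [← @inner_self_eq_norm_sq ℂ]
    rw [hon.inner_sum, map_sum]
    refine Finset.sum_congr rfl fun i _ => ?_
    rw [RCLike.conj_mul]
    norm_cast
  set w := ∑ i : F, x i • u (i : κ) with hw
  -- `g` plays the role of `(D + V - c) w`, so `g - V w` is `(D - c) w`. Its norm is at most `(r +
  -- ‖V‖)‖w‖` and, since `w` has no coefficients in `M`, at least `ρ‖w‖`.
  set g := ∑ i : F, (((e i - c : ℝ) : ℂ) * x i) • u (i : κ) with hg
  have hwpos : 0 < ‖w‖ := by
    rw [norm_pos_iff]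
    intro h0
    apply hx0
    have := hnorm x
    rw [← hw, h0] at this
    simp only [norm_zero, ne_eq, OfNat.ofNat_ne_zero, not_false_eq_true, zero_pow] at this
    have h3 := (Finset.sum_eq_zero_iff_of_nonneg (fun i _ => by positivity)).1 this.symm
    ext i
    simpa using h3 i (Finset.mem_univ _)
  have hgw : ‖g‖ ≤ r * ‖w‖ := by
    refine abs_le_of_sq_le_sq' ?_ (by positivity) |>.2
    rw [mul_pow, hg, hnorm, hw, hnorm, Finset.mul_sum]
    refine Finset.sum_le_sum fun i _ => ?_
    rw [norm_mul, mul_pow]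
    gcongr
    rw [Complex.norm_real, Real.norm_eq_abs]
    exact hF i i.2
  have hcoef : ∀ m, ((d m - c : ℝ) : ℂ) * ⟪b m, w⟫_ℂ = ⟪b m, g - V w⟫_ℂ := by
    intro m
    rw [inner_sub_right, hw, hg, map_sum, inner_sum, inner_sum, inner_sum, Finset.mul_sum,
      ← Finset.sum_sub_distrib]
    refine Finset.sum_congr rfl fun i _ => ?_
    have := h m i
    rw [map_smul, inner_smul_right, inner_smul_right, inner_smul_right]
    push_cast
    linear_combination (x i) * this
  have hle : ρ ^ 2 * ‖w‖ ^ 2 ≤ ‖g - V w‖ ^ 2 := by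
    refine hasSum_le (fun m => ?_) ((b.hasSum_sq_norm_inner w).mul_left (ρ ^ 2))
      (b.hasSum_sq_norm_inner (g - V w))
    by_cases hm : m ∈ M
    · have : ⟪b m, w⟫_ℂ = 0 := congrFun hx ⟨m, hm⟩
      simp [this]
    · rw [← hcoef, norm_mul, mul_pow]
      have h1 := hM m hm
      have h2 : 0 ≤ ρ := by linarith [norm_nonneg V]
      gcongr
      rwa [Complex.norm_real, Real.norm_eq_abs]
  have h1 : ‖g - V w‖ ≤ (r + ‖V‖) * ‖w‖ := by
    calc _ ≤ ‖g‖ + ‖V w‖ := norm_sub_le _ _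
      _ ≤ r * ‖w‖ + ‖V‖ * ‖w‖ := add_le_add hgw (V.le_opNorm w)
      _ = _ := by ring
  have h2 : ρ * ‖w‖ ≤ ‖g - V w‖ := by
    refine abs_le_of_sq_le_sq' ?_ (by positivity) |>.2
    rw [mul_pow]; exact hle
  nlinarith

/-- The operator that is diagonal in the Hilbert basis `b`, with summable eigenvalues `r`. -/
def diagonal (b : HilbertBasis ι ℂ H) (r : ι → ℂ) : H →L[ℂ] H :=
  ∑' m, r m • (innerSL ℂ (b m)).smulRight (b m)

theorem hasSum_diagonal [CompleteSpace H] (b : HilbertBasis ι ℂ H) {r : ι → ℂ} (hr : Summable r) :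
    HasSum (fun m => r m • (innerSL ℂ (b m)).smulRight (b m)) (b.diagonal r) := by
  refine Summable.hasSum (Summable.of_norm_bounded hr.norm fun m => ?_)
  rw [norm_smul, ContinuousLinearMap.norm_smulRight_apply, innerSL_apply_norm,
    b.orthonormal.1 m]
  simp

theorem inner_diagonal [CompleteSpace H] (b : HilbertBasis ι ℂ H) {r : ι → ℂ} (hr : Summable r)
    (m : ι) (x : H) : ⟪b m, b.diagonal r x⟫_ℂ = r m * ⟪b m, x⟫_ℂ := by
  classical
  have h1 := ((b.hasSum_diagonal hr).mapL
    ((innerSL ℂ (b m)).comp (ContinuousLinearMap.apply ℂ H x)) )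
  refine h1.unique ?_
  convert! hasSum_ite_eq m (r m * ⟪b m, x⟫_ℂ) using 1
  ext k
  simp only [ContinuousLinearMap.comp_apply, ContinuousLinearMap.apply_apply,
    _root_.smul_apply, ContinuousLinearMap.smulRight_apply, innerSL_apply_apply,
    inner_smul_right, orthonormal_iff_ite.1 b.orthonormal m k]
  by_cases hk : k = m
  · simp [hk]
  · simp [hk, Ne.symm hk]

theorem isCompactOperator_diagonal [CompleteSpace H] (b : HilbertBasis ι ℂ H) {r : ι → ℂ}
    (hr : Summable r) : IsCompactOperator (b.diagonal r) := by
  refine isCompactOperator_of_tendsto (b.hasSum_diagonal hr) (Eventually.of_forall fun s => ?_)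
  have hmem : ∑ m ∈ s, r m • (innerSL ℂ (b m)).smulRight (b m) ∈
      compactOperator (RingHom.id ℂ) H H := by
    refine Submodule.sum_mem _ fun m _ => Submodule.smul_mem _ _ ?_
    change IsCompactOperator _
    have : IsCompactOperator ((ContinuousLinearMap.id ℂ ℂ).smulRight (b m)) :=
      isCompactOperator_of_locallyCompactSpace_rng _
    exact this.comp_clm (innerSL ℂ (b m))
  exact hmem

end HilbertBasis

-- Eigenbasis of a diagonal operator plus a bounded symmetric one.

universe u

/-- The eigenspaces are mutually orthogonal and only `0` is orthogonal to all of them, so Hilbert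
bases of the eigenspaces, the possibly infinite-dimensional kernel included, glue together. Here `z`
runs over all of `ℂ`; values that are not eigenvalues contribute no vectors. -/
theorem LinearMap.IsSymmetric.exists_hilbertBasis_eigenvectors {H : Type u} [NormedAddCommGroup H]
    [InnerProductSpace ℂ H] [CompleteSpace H] {K : H →L[ℂ] H} (hs : K.IsSymmetric)
    (hK : IsCompactOperator K) :
    ∃ (κ : Type u) (u : HilbertBasis κ ℂ H) (e : κ → ℝ), ∀ i, K (u i) = (e i : ℂ) • u i := by
  let E : ℂ → Submodule ℂ H := fun z => Module.End.eigenspace (K : Module.End ℂ H) z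
  have hmem : ∀ {z x}, x ∈ E z ↔ K x = z • x := Module.End.mem_eigenspace_iff
  have hcl : ∀ z, IsClosed (E z : Set H) := by
    intro z
    have : (E z : Set H) = {x | K x = z • x} := Set.ext fun x => hmem
    rw [this]
    exact isClosed_eq K.continuous (continuous_const_smul z)
  have hcomp : ∀ z, CompleteSpace (E z) := fun z => (hcl z).completeSpace_coe
  choose w v hv using fun z => exists_hilbertBasis ℂ (E z)
  have hon := hs.orthogonalFamily_eigenspaces.orthonormal_sigma_orthonormal
    (fun z => (v z).orthonormal)
  have hbot : (Submodule.span ℂ (Set.range fun a : Σ z, w z => ((v a.1 a.2 : E a.1) : H)))ᗮ = ⊥ := by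
    rw [eq_bot_iff, ← ContinuousLinearMap.orthogonalComplement_iSup_eigenspaces_eq_bot hK hs]
    intro x hx
    rw [← Submodule.iInf_orthogonal, Submodule.mem_iInf]
    intro z
    rw [Submodule.mem_orthogonal] at hx ⊢
    intro y hy
    have h1 := ((v z).hasSum_repr ⟨y, hy⟩).mapL ((innerSL ℂ x).comp (E z).subtypeL)
    have h2 : ⟪x, y⟫_ℂ = 0 := by
      refine h1.unique ?_
      convert! hasSum_zero using 1
      ext i
      have h3 := hx (v z i : E z) (Submodule.subset_span ⟨⟨z, i⟩, rfl⟩)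
      rw [inner_eq_zero_symm] at h3
      simp [h3]
    rwa [inner_eq_zero_symm] at h2
  let u := HilbertBasis.mkOfOrthogonalEqBot hon hbot
  refine ⟨_, u, fun a => a.1.re, fun a => ?_⟩
  have h0 : u a = (v a.1 a.2 : E a.1) :=
    congrFun (HilbertBasis.coe_mkOfOrthogonalEqBot hon hbot) a
  have h1 : K (u a) = a.1 • u a := by
    rw [h0]
    exact hmem.1 (v a.1 a.2).2
  have h2 := hs.conj_eigenvalue_eq_self (Module.End.hasEigenvalue_of_hasEigenvector
    ⟨hmem.2 h1, u.orthonormal.ne_zero a⟩)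
  rw [h1, Complex.conj_eq_iff_re.1 h2]

namespace HilbertBasis

variable {ι κ : Type*} {H : Type u} [NormedAddCommGroup H] [InnerProductSpace ℂ H]

/-- The eigenspace at `z` of `D + V`, where `D` is diagonal in the Hilbert basis `b`, with
eigenvalues `d`. -/
def diagAddEigenspace (b : HilbertBasis ι ℂ H) (d : ι → ℝ) (V : H →L[ℂ] H) (z : ℂ) :
    Submodule ℂ H where
  carrier := {u | ∀ m, (d m : ℂ) * ⟪b m, u⟫_ℂ + ⟪b m, V u⟫_ℂ = z * ⟪b m, u⟫_ℂ}
  zero_mem' := by simp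
  add_mem' := by
    intro u v hu hv m
    rw [map_add, inner_add_right, inner_add_right]
    linear_combination hu m + hv m
  smul_mem' := by
    intro c u hu m
    rw [map_smul, inner_smul_right, inner_smul_right]
    linear_combination c * hu m

variable {b : HilbertBasis ι ℂ H} {d : ι → ℝ} {V : H →L[ℂ] H}

/-- On an eigenvector the unbounded `D` acts as `z - V`, which stays in `H`, so Parseval's identity
moves the real entries `d m` from one factor to the other. -/
theorem inner_mul_sub_eq_zero (hV : V.IsSymmetric) {z w : ℂ} {u v : H}
    (hu : u ∈ b.diagAddEigenspace d V z) (hv : v ∈ b.diagAddEigenspace d V w) :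
    (z - starRingEnd ℂ w) * ⟪v, u⟫_ℂ = 0 := by
  have h1 : ⟪v, z • u - V u⟫_ℂ = ⟪w • v - V v, u⟫_ℂ := by
    refine (b.hasSum_inner_mul_inner v (z • u - V u)).unique ?_
    convert! b.hasSum_inner_mul_inner (w • v - V v) u using 1
    ext m
    have e1 : ⟪b m, z • u - V u⟫_ℂ = d m * ⟪b m, u⟫_ℂ := by
      rw [inner_sub_right, inner_smul_right, ← hu m]; ring
    have e2 : ⟪b m, w • v - V v⟫_ℂ = d m * ⟪b m, v⟫_ℂ := by
      rw [inner_sub_right, inner_smul_right, ← hv m]; ring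
    rw [e1, ← inner_conj_symm (w • v - V v) (b m), e2, ← inner_conj_symm v (b m), map_mul,
      Complex.conj_ofReal]
    ring
  rw [inner_sub_right, inner_sub_left, inner_smul_right, inner_smul_left] at h1
  have h2 : ⟪V v, u⟫_ℂ = ⟪v, V u⟫_ℂ := hV v u
  linear_combination h1 - h2

theorem diagAddEigenspace_eq_span (hV : V.IsSymmetric) (u : HilbertBasis κ ℂ H) {e : κ → ℝ}
    (he : ∀ i, u i ∈ b.diagAddEigenspace d V (e i)) {z : ℂ}
    (hfin : {i | (e i : ℂ) = z}.Finite) :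
    b.diagAddEigenspace d V z = Submodule.span ℂ (Set.range fun i : {i | (e i : ℂ) = z} => u i) := by
  refine le_antisymm (fun x hx => ?_) ?_
  · have h0 : ∀ i ∉ hfin.toFinset, (u.repr x i) • u i = 0 := by
      intro i hi
      have h1 := inner_mul_sub_eq_zero hV hx (he i)
      rw [Complex.conj_ofReal, mul_eq_zero, sub_eq_zero] at h1
      rw [u.repr_apply_apply, h1.resolve_left, zero_smul]
      intro h2
      exact hi (by simp [h2])
    have h1 : HasSum (fun i => u.repr x i • u i) _ := hasSum_sum_of_ne_finset_zero h0
    rw [(u.hasSum_repr x).unique h1]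
    refine Submodule.sum_mem _ fun i hi => Submodule.smul_mem _ _ (Submodule.subset_span ?_)
    exact ⟨⟨i, by simpa using hi⟩, rfl⟩
  · rw [Submodule.span_le]
    rintro _ ⟨⟨i, hi⟩, rfl⟩
    have := he i
    rwa [show (e i : ℂ) = z from hi] at this

theorem finrank_diagAddEigenspace (hV : V.IsSymmetric) (u : HilbertBasis κ ℂ H) {e : κ → ℝ}
    (he : ∀ i, u i ∈ b.diagAddEigenspace d V (e i)) {z : ℂ}
    (hfin : {i | (e i : ℂ) = z}.Finite) :
    FiniteDimensional ℂ (b.diagAddEigenspace d V z) ∧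
    {i | (e i : ℂ) = z}.ncard = Module.finrank ℂ (b.diagAddEigenspace d V z) := by
  have := hfin.fintype
  rw [diagAddEigenspace_eq_span hV u he hfin]
  refine ⟨FiniteDimensional.span_of_finite ℂ (Set.finite_range _), ?_⟩
  have hli := (u.orthonormal.comp (Subtype.val : {i | (e i : ℂ) = z} → κ)
    Subtype.coe_injective).linearIndependent
  have := finrank_span_eq_card hli
  rw [Function.comp_def] at this
  rw [this, ← Nat.card_coe_set_eq, Nat.card_eq_fintype_card]

/-- With `R = (D + s)⁻¹`, the operator `R (1 + V R)⁻¹` is the inverse of `D + V + s`; it is compact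
and symmetric, and its eigenvectors are those of `D + V`. The shift `s = ‖V‖ + 1` makes `‖V R‖ < 1`,
so that a Neumann series inverts `1 + V R`. -/
theorem exists_hilbertBasis_diagAddEigenspace [CompleteSpace H] (b : HilbertBasis ι ℂ H)
    (hV : V.IsSymmetric) (hd : ∀ m, 0 ≤ d m) (hsum : Summable fun m => (d m + (‖V‖ + 1))⁻¹) :
    ∃ (κ : Type u) (u : HilbertBasis κ ℂ H) (e : κ → ℝ),
      ∀ i, u i ∈ b.diagAddEigenspace d V (e i) := by
  set s := ‖V‖ + 1 with hs
  have hspos : 0 < s := by positivity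
  let r : ι → ℂ := fun m => (((d m + s)⁻¹ : ℝ) : ℂ)
  have hr : Summable r := Complex.ofRealCLM.summable hsum
  set R := b.diagonal r with hR
  have hRb : ∀ m x, ⟪b m, R x⟫_ℂ = r m * ⟪b m, x⟫_ℂ := b.inner_diagonal hr
  have hr0 : ∀ m, r m * (d m + s) = 1 := by
    intro m
    have : d m + s ≠ 0 := by linarith [hd m]
    simp only [r]
    norm_cast
    field_simp
  have hRsymm : ∀ x y, ⟪R x, y⟫_ℂ = ⟪x, R y⟫_ℂ := by
    intro x y
    refine (b.hasSum_inner_mul_inner (R x) y).unique ?_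
    convert! b.hasSum_inner_mul_inner x (R y) using 1
    ext m
    rw [hRb, ← inner_conj_symm (R x) (b m), hRb, map_mul, ← inner_conj_symm x (b m),
      Complex.conj_ofReal]
    ring
  have hRnorm : ‖R‖ ≤ s⁻¹ := by
    refine ContinuousLinearMap.opNorm_le_bound _ (by positivity) fun x => ?_
    refine abs_le_of_sq_le_sq' ?_ (by positivity) |>.2
    rw [mul_pow]
    refine hasSum_le (fun m => ?_) (b.hasSum_sq_norm_inner (R x))
      ((b.hasSum_sq_norm_inner x).mul_left _)
    rw [hRb, norm_mul, mul_pow]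
    gcongr
    simp only [r]
    rw [Complex.norm_real, Real.norm_of_nonneg (by have := hd m; positivity)]
    exact inv_anti₀ hspos (by linarith [hd m])
  have hlt : ‖-(V * R)‖ < 1 := by
    rw [norm_neg]
    calc ‖V * R‖ ≤ ‖V‖ * ‖R‖ := norm_mul_le _ _
      _ ≤ ‖V‖ * s⁻¹ := by gcongr
      _ < 1 := by rw [← div_eq_mul_inv, div_lt_one hspos]; linarith
  let B := Units.oneSub _ hlt
  have hB : ∀ x, (B : H →L[ℂ] H) x = x + V (R x) := by
    intro x
    simp [B, Units.val_oneSub]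
  let Bi : H →L[ℂ] H := ((B⁻¹ : (H →L[ℂ] H)ˣ) : H →L[ℂ] H)
  have hBi : ∀ x, Bi x + V (R (Bi x)) = x := by
    intro x
    rw [← hB, ← mul_apply_eq_comp, Units.mul_inv]
    rfl
  let K : H →L[ℂ] H := R * Bi
  have hKc : IsCompactOperator K := (b.isCompactOperator_diagonal hr).comp_clm Bi
  have hKs : K.IsSymmetric := by
    intro x y
    change ⟪R (Bi x), y⟫_ℂ = ⟪x, R (Bi y)⟫_ℂ
    -- Writing `x` and `y` as images under `1 + V R` gives expressions in `Bi x` and `Bi y` that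
    -- agree by the symmetry of `R` and `V`.
    conv_lhs => rw [← hBi y]
    conv_rhs => rw [← hBi x]
    have h2 : ∀ x y, ⟪V x, y⟫_ℂ = ⟪x, V y⟫_ℂ := hV
    rw [inner_add_left, inner_add_right, hRsymm, h2]
  obtain ⟨κ, u, e, he⟩ := hKs.exists_hilbertBasis_eigenvectors hKc
  refine ⟨κ, u, fun i => (e i)⁻¹ - s, fun i m => ?_⟩
  have hKu : R (Bi (u i)) = (e i : ℂ) • u i := he i
  have hcoef : ∀ m, r m * ⟪b m, Bi (u i)⟫_ℂ = e i * ⟪b m, u i⟫_ℂ := by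
    intro m
    rw [← hRb, hKu, inner_smul_right]
  have hBu := hBi (u i)
  rw [hKu, map_smul] at hBu
  -- `R` has no zero diagonal entry, hence is injective, so `0` is not an eigenvalue of `K`.
  have hei : (e i : ℂ) ≠ 0 := by
    intro h0
    apply u.orthonormal.ne_zero i
    have h1 : Bi (u i) = 0 := b.ext_inner fun m => by
      have := hcoef m
      rw [h0, zero_mul] at this
      rw [inner_zero_right]
      linear_combination (d m + s) * this - ⟪b m, Bi (u i)⟫_ℂ * hr0 m
    rw [← hBu, h1, h0]
    simp
  have h1 := congrArg (fun x => ⟪b m, x⟫_ℂ) hBu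
  simp only [inner_add_right, inner_smul_right] at h1
  have h2 := hcoef m
  have h3 : ⟪b m, Bi (u i)⟫_ℂ = (d m + s) * (e i * ⟪b m, u i⟫_ℂ) := by
    linear_combination (d m + s) * h2 - ⟪b m, Bi (u i)⟫_ℂ * hr0 m
  rw [h3] at h1
  push_cast
  apply mul_left_cancel₀ hei
  have h4 : (e i : ℂ) * (e i : ℂ)⁻¹ = 1 := mul_inv_cancel₀ hei
  linear_combination h1 - ⟪b m, u i⟫_ℂ * h4

end HilbertBasis

/-! ### Enumeration in increasing order. -/

theorem nonempty_orderIso_nat_of_finite_Iic {κ : Type*} [LinearOrder κ] [Infinite κ]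
    (hIic : ∀ j : κ, (Set.Iic j).Finite) : Nonempty (κ ≃o ℕ) := by
  classical
  have hex : ∃ i : κ, ∀ j, i ≤ j := by
    obtain ⟨i0⟩ : Nonempty κ := inferInstance
    obtain ⟨i, hi, hmin⟩ := (hIic i0).exists_minimal ⟨i0, le_refl i0⟩
    refine ⟨i, fun j => ?_⟩
    rcases le_total i j with h | h
    · exact h
    · exact hmin (h.trans hi) h
  let : OrderBot κ := { bot := hex.choose, bot_le := hex.choose_spec }
  let : LocallyFiniteOrder κ := LocallyFiniteOrder.ofFiniteIcc fun i j =>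
    (hIic j).subset fun x hx => hx.2
  have : NoMaxOrder κ := ⟨fun i => by
    by_contra! h
    exact Set.infinite_univ.mono (fun x _ => h x) (hIic i)⟩
  let : SuccOrder κ := LinearLocallyFiniteOrder.succOrder κ
  let : PredOrder κ := LinearLocallyFiniteOrder.predOrder κ
  exact ⟨orderIsoNatOfLinearSuccPredArch⟩

theorem exists_pnat_equiv_monotone {κ : Type*} [Infinite κ] (e : κ → ℝ)
    (hfin : ∀ x, {i | e i ≤ x}.Finite) :
    ∃ σ : ℕ+ ≃ κ, Monotone (e ∘ σ) := by
  have hcount : Countable κ := by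
    have h : (Set.univ : Set κ) = ⋃ n : ℕ, {i | e i ≤ n} := by
      ext i
      simpa using exists_nat_ge (e i)
    rw [← Set.countable_univ_iff, h]
    exact Set.countable_iUnion fun n => (hfin n).countable
  obtain ⟨g, hg⟩ := exists_injective_nat κ
  -- Ties between equal values of `e` are broken by an arbitrary injection into `ℕ`.
  let f : κ → ℝ ×ₗ ℕ := fun i => toLex (e i, g i)
  have hf : Function.Injective f := fun i j h => hg (congrArg (fun p => (ofLex p).2) h)
  let O : LinearOrder κ := LinearOrder.lift' f hf
  have hle : ∀ i j : κ, i ≤ j → e i ≤ e j := by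
    intro i j h
    have h1 : f i ≤ f j := h
    rw [Prod.Lex.le_iff] at h1
    rcases h1 with h1 | h1
    · exact h1.le
    · exact h1.1.le
  obtain ⟨τ⟩ := nonempty_orderIso_nat_of_finite_Iic
    fun j : κ => (hfin (e j)).subset fun i hi => hle i j hi
  refine ⟨Equiv.pnatEquivNat.trans τ.symm.toEquiv, fun k l hkl => hle _ _ ?_⟩
  exact τ.symm.monotone (by simpa using hkl)

/-! ### Perturbations of the half-integer spectrum: two eigenvalues per window. -/

/-- The square of the `m`-th half-integer. -/
def halfIntSq (m : ℤ) : ℝ := ((m : ℝ) + 1 / 2) ^ 2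

theorem halfIntSq_nonneg (m : ℤ) : 0 ≤ halfIntSq m := sq_nonneg _

/-- The map `m ↦ -1 - m` is the reflection of `m + 1/2` about the origin; it pairs the two modes of
each double eigenvalue. -/
theorem halfIntSq_neg_one_sub (m : ℤ) : halfIntSq (-1 - m) = halfIntSq m := by
  unfold halfIntSq; push_cast; ring

theorem summable_inv_halfIntSq_add {s : ℝ} (hs : 0 ≤ s) :
    Summable fun m => (halfIntSq m + s)⁻¹ := by
  have h := (Real.summable_one_div_int_add_rpow (1 / 2) 2).2 (by norm_num)
  refine Summable.of_nonneg_of_le (fun m => ?_) (fun m => ?_) h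
  · have := halfIntSq_nonneg m
    positivity
  · have hne : (m : ℝ) + 1 / 2 ≠ 0 := by
      intro h0
      have h1 : (2 * m + 1 : ℤ) = 0 := by
        have : (2 * (m : ℝ) + 1) = 0 := by linarith
        exact_mod_cast this
      omega
    rw [one_div, Real.rpow_two, sq_abs]
    apply inv_anti₀
    · positivity
    · simpa [halfIntSq] using hs

theorem finite_halfIntSq_le (x : ℝ) : {m | halfIntSq m ≤ x}.Finite := by
  refine (Set.finite_Icc (-⌈x + 1⌉) ⌈x + 1⌉).subset fun m hm => ?_
  have hm : ((m : ℝ) + 1 / 2) ^ 2 ≤ x := hm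
  have h1 := Int.le_ceil (x + 1)
  constructor
  · have : (-⌈x + 1⌉ : ℝ) ≤ m := by nlinarith [sq_nonneg ((m : ℝ) + 1)]
    exact_mod_cast this
  · have : (m : ℝ) ≤ ⌈x + 1⌉ := by nlinarith
    exact_mod_cast this

namespace HilbertBasis

variable {ι κ : Type*} {H : Type u} [NormedAddCommGroup H] [InnerProductSpace ℂ H]
  {V : H →L[ℂ] H} {b : HilbertBasis ℤ ℂ H} {e : κ → ℝ}

theorem finite_le_of_perturbation (u : HilbertBasis κ ℂ H)
    (h : ∀ i, u i ∈ b.diagAddEigenspace halfIntSq V (e i)) (x : ℝ) : {i | e i ≤ x}.Finite := by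
  -- Counting with the single index `i`, radius `0` and empty `M`: an eigenvalue below `-(‖V‖ + 1)`
  -- would be too far from every `d m ≥ 0`.
  have hlow : ∀ i, -(‖V‖ + 1) ≤ e i := by
    intro i
    by_contra! hlt
    have := b.card_le_card_of_perturbation u halfIntSq e V (fun m i => h i m) (c := e i) (r := 0)
      (ρ := ‖V‖ + 1) (by linarith) le_rfl {i} (by simp) ∅ (fun m _ => by
        have := halfIntSq_nonneg m
        rw [abs_of_nonneg] <;> linarith [norm_nonneg V])
    simp at this
  set r := max (|x|) (‖V‖ + 1) with hr
  have hr0 : 0 ≤ r := (abs_nonneg x).trans (le_max_left _ _)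
  refine Set.not_infinite.1 fun hinf => ?_
  set M := (finite_halfIntSq_le (r + ‖V‖ + 1)).toFinset with hM
  obtain ⟨F, hF, hcard⟩ := hinf.exists_subset_card_eq (M.card + 1)
  have := b.card_le_card_of_perturbation u halfIntSq e V (fun m i => h i m) (c := 0) (r := r)
    (ρ := r + ‖V‖ + 1) (by linarith) hr0 F (fun i hi => by
      rw [sub_zero, abs_le]
      have h1 : e i ≤ x := hF hi
      constructor
      · linarith [hlow i, le_max_right (|x|) (‖V‖ + 1)]
      · exact h1.trans ((le_abs_self x).trans (le_max_left _ _))) M (fun m hm => by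
      simp only [hM, Set.Finite.mem_toFinset, Set.mem_ofPred_eq, not_le] at hm
      rw [sub_zero]
      exact hm.le.trans (le_abs_self _))
  omega

/-- `D` is the perturbation of `D + V` by `-V`; this lets the counting lemma be applied with the two
bases exchanged. -/
theorem relation_symm {d : ι → ℝ} {b : HilbertBasis ι ℂ H} (hV : V.IsSymmetric)
    (u : HilbertBasis κ ℂ H) (h : ∀ i, u i ∈ b.diagAddEigenspace d V (e i)) (i : κ) (m : ι) :
    (e i : ℂ) * ⟪u i, b m⟫_ℂ + ⟪u i, (-V) (b m)⟫_ℂ = d m * ⟪u i, b m⟫_ℂ := by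
  have h1 := congrArg (starRingEnd ℂ) (h i m)
  have h2 : ⟪V (u i), b m⟫_ℂ = ⟪u i, V (b m)⟫_ℂ := hV _ _
  simp only [map_add, map_mul, Complex.conj_ofReal, inner_conj_symm] at h1
  rw [_root_.neg_apply, inner_neg_right, ← h2]
  linear_combination -h1

theorem infinite_of_perturbation (hV : V.IsSymmetric) (u : HilbertBasis κ ℂ H)
    (h : ∀ i, u i ∈ b.diagAddEigenspace halfIntSq V (e i)) : Infinite κ := by
  by_contra hfin
  rw [not_infinite_iff_finite] at hfin
  have := Fintype.ofFinite κ
  obtain ⟨F, -, hF⟩ := (Set.infinite_univ (α := ℤ)).exists_subset_card_eq (Fintype.card κ + 1)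
  have hpos : ∀ m ∈ F, |halfIntSq m - 0| ≤ ∑ m ∈ F, halfIntSq m := fun m hm => by
    rw [sub_zero, abs_of_nonneg (halfIntSq_nonneg m)]
    exact Finset.single_le_sum (fun k _ => halfIntSq_nonneg k) hm
  have := u.card_le_card_of_perturbation b e halfIntSq (-V) (relation_symm hV u h)
    (lt_add_one _) (Finset.sum_nonneg fun m _ => halfIntSq_nonneg m) F hpos Finset.univ
    (fun m hm => absurd (Finset.mem_univ m) hm)
  rw [Finset.card_univ] at this
  omega

theorem exists_reindex [CompleteSpace H] (u : HilbertBasis κ ℂ H) (σ : ι ≃ κ) :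
    ∃ v : HilbertBasis ι ℂ H, ∀ i, v i = u (σ i) := by
  have hon : Orthonormal ℂ (fun i => u (σ i)) := u.orthonormal.comp _ σ.injective
  refine ⟨HilbertBasis.mk hon ?_, fun i => by rw [HilbertBasis.coe_mk]⟩
  rw [show (fun i => u (σ i)) = u ∘ σ from rfl, σ.surjective.range_comp, u.dense_span]

/-- The eigenvectors of `D + V`, sorted by their eigenvalues. -/
theorem exists_sorted_eigenbasis [CompleteSpace H] (b : HilbertBasis ℤ ℂ H) (hV : V.IsSymmetric) :
    ∃ (u : HilbertBasis ℕ+ ℂ H) (μ : ℕ+ → ℝ), Monotone μ ∧ Tendsto μ atTop atTop ∧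
      ∀ k, u k ∈ b.diagAddEigenspace halfIntSq V (μ k) := by
  obtain ⟨κ, u, e, he⟩ := b.exists_hilbertBasis_diagAddEigenspace hV halfIntSq_nonneg
    (summable_inv_halfIntSq_add (by positivity))
  have hinf := infinite_of_perturbation hV u he
  obtain ⟨σ, hσ⟩ := exists_pnat_equiv_monotone e (finite_le_of_perturbation u he)
  obtain ⟨v, hv⟩ := exists_reindex u σ
  refine ⟨v, e ∘ σ, hσ, ?_, fun k => ?_⟩
  · refine tendsto_atTop_atTop_of_monotone hσ fun x => ?_
    by_contra! h
    have hfin := finite_le_of_perturbation u he x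
    exact Set.infinite_univ.mono (fun i _ => by simpa using (h (σ.symm i)).le) hfin
  · rw [hv]
    exact he (σ k)

/-- The window has midpoint `c = n² + n + 1/2` and half-length `n + 1/2`. All half-integer squares
except those of `n` and `-1 - n` are at least `2n` away from `c`, which gives at most two
eigenvalues. Conversely `(n + 1/2)² = c - 1/4`, while eigenvalues outside the window are at least `n
+ 1/2` away, which gives at least two. -/
theorem ncard_cluster (hV : V.IsSymmetric) {μ : ℕ+ → ℝ} 
    (u : HilbertBasis ℕ+ ℂ H)
    (h : ∀ k, u k ∈ b.diagAddEigenspace halfIntSq V (μ k)) {n : ℕ} (hn : ‖V‖ + 1 < n) :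
    {k | (n : ℝ) ^ 2 < μ k ∧ μ k ≤ ((n : ℝ) + 1) ^ 2}.ncard = 2 := by
  have hfin : {k | (n : ℝ) ^ 2 < μ k ∧ μ k ≤ ((n : ℝ) + 1) ^ 2}.Finite :=
    (finite_le_of_perturbation u h (((n : ℝ) + 1) ^ 2)).subset fun k hk => hk.2
  have hV0 := norm_nonneg V
  have hne : (n : ℤ) ≠ -1 - n := by omega
  have hcard : ({(n : ℤ), -1 - (n : ℤ)} : Finset ℤ).card = 2 := Finset.card_pair hne
  rw [Set.ncard_eq_toFinset_card _ hfin]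
  apply le_antisymm
  · refine le_of_le_of_eq ?_ hcard
    refine b.card_le_card_of_perturbation u halfIntSq μ V (fun m i => h i m)
      (c := (n : ℝ) ^ 2 + n + 1 / 2) (r := n + 1 / 2) (ρ := 2 * n) (by linarith) (by positivity)
      _ (fun k hk => ?_) _ (fun m hm => ?_)
    · rw [Set.Finite.mem_toFinset] at hk
      rw [abs_le]
      constructor <;> nlinarith [hk.1, hk.2]
    · simp only [Finset.mem_insert, Finset.mem_singleton, not_or] at hm
      unfold halfIntSq
      rw [le_abs]
      have hcases : (n : ℤ) + 1 ≤ m ∨ (0 ≤ m ∧ m ≤ n - 1) ∨ (-n ≤ m ∧ m ≤ -1) ∨ m ≤ -2 - n := by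
        omega
      rcases hcases with h1 | ⟨h1, h2⟩ | ⟨h1, h2⟩ | h1
      · left
        have h1 : (n : ℝ) + 1 ≤ m := by exact_mod_cast h1
        nlinarith
      · right
        have h1 : (0 : ℝ) ≤ m := by exact_mod_cast h1
        have h2 : (m : ℝ) ≤ n - 1 := by exact_mod_cast h2
        nlinarith
      · right
        have h1 : (-n : ℝ) ≤ m := by exact_mod_cast h1
        have h2 : (m : ℝ) ≤ -1 := by exact_mod_cast h2
        nlinarith
      · left
        have h1 : (m : ℝ) ≤ -2 - n := by exact_mod_cast h1
        nlinarith
  · refine le_of_eq_of_le hcard.symm ?_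
    refine u.card_le_card_of_perturbation b μ halfIntSq (-V) (relation_symm hV u h)
      (c := (n : ℝ) ^ 2 + n + 1 / 2) (r := 1 / 4) (ρ := n + 1 / 2) (by rw [norm_neg]; linarith)
      (by positivity) _ (fun k hk => ?_) _ (fun m hm => ?_)
    · have : halfIntSq k = ((n : ℝ) + 1 / 2) ^ 2 := by
        simp only [Finset.mem_insert, Finset.mem_singleton] at hk
        rcases hk with rfl | rfl
        · simp [halfIntSq]
        · rw [halfIntSq_neg_one_sub]; simp [halfIntSq]
      rw [this, abs_le]
      constructor <;> nlinarith
    · simp only [Set.Finite.mem_toFinset, Set.mem_ofPred_eq, not_and_or, not_lt, not_le] at hm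
      rw [le_abs]
      rcases hm with hm | hm
      · right; nlinarith
      · left; nlinarith

end HilbertBasis

/-! ### Labelling the sorted eigenvalues by integers. -/

/-- The index `n ∈ ℕ` with `j = n` or `j = -1 - n`, so that `(n + 1/2)² = (j + 1/2)²`. -/
def foldIndex (j : ℤ) : ℕ := if 0 ≤ j then j.toNat else (-1 - j).toNat

theorem foldIndex_cases (j : ℤ) : j = foldIndex j ∨ j = -1 - (foldIndex j : ℤ) := by
  unfold foldIndex; split_ifs <;> omega

/-- The number `c n` of eigenvalues up to `n²` grows by two at each step from `N` on. Thus the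
window of `n` holds the positions `c n + 1` and `c n + 2`, given to `j = n` and `j = -1 - n`. -/
theorem exists_equiv_of_ncard_eq_two {μ : ℕ+ → ℝ} (hmono : Monotone μ)
    (htend : Tendsto μ atTop atTop) (N : ℕ)
    (hcard : ∀ n : ℕ, N ≤ n → {k | (n : ℝ) ^ 2 < μ k ∧ μ k ≤ ((n : ℝ) + 1) ^ 2}.ncard = 2) :
    ∃ (kstar : ℕ) (σ : {j : ℤ // ((N + 1 : ℕ) : ℤ) ≤ |j|} ≃ {k : ℕ+ // kstar < (k : ℕ)}),
      ∀ j : {j : ℤ // ((N + 1 : ℕ) : ℤ) ≤ |j|}, (foldIndex j : ℝ) ^ 2 < μ (σ j : ℕ+) ∧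
        μ (σ j : ℕ+) ≤ ((foldIndex j : ℝ) + 1) ^ 2 := by
  have hfin : ∀ x, {k | μ k ≤ x}.Finite := by
    intro x
    obtain ⟨K, hK⟩ := (htend.eventually_gt_atTop x).exists_forall_of_atTop
    exact (Set.finite_Iio K).subset fun k hk => by
      by_contra! h
      exact absurd (hK k (by simpa using h)) (not_lt.2 hk)
  let c : ℕ → ℕ := fun n => {k | μ k ≤ (n : ℝ) ^ 2}.ncard
  have hc : ∀ (n : ℕ) (k : ℕ+), (k : ℕ) ≤ c n ↔ μ k ≤ (n : ℝ) ^ 2 := by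
    intro n k
    constructor
    · intro h
      by_contra! hlt
      have h1 : {l | μ l ≤ (n : ℝ) ^ 2} ⊆ Set.Iio k := fun l hl => by
        by_contra! h2
        exact absurd (hmono (not_lt.1 h2)) (not_le.2 (lt_of_le_of_lt hl hlt))
      have h2 := Set.ncard_le_ncard h1 (Set.finite_Iio k)
      have h3 : (Set.Iio k).ncard = (k : ℕ) - 1 := by
        rw [show Set.Iio k = Set.Ico 1 k from Set.ext fun x => by simp, ← Finset.coe_Ico,
          Set.ncard_coe_finset, PNat.card_Ico, PNat.one_coe]
      have := k.pos
      simp only [c] at h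
      omega
    · intro h
      have h1 : Set.Iic k ⊆ {l | μ l ≤ (n : ℝ) ^ 2} := fun l hl => (hmono hl).trans h
      have h2 := Set.ncard_le_ncard h1 (hfin _)
      have h3 : (Set.Iic k).ncard = (k : ℕ) := by
        rw [show Set.Iic k = Set.Icc 1 k from Set.ext fun x => by simp, ← Finset.coe_Icc,
          Set.ncard_coe_finset, PNat.card_Icc, PNat.one_coe, Nat.add_sub_cancel]
      simp only [c]
      omega
  have hstep : ∀ n, N ≤ n → c (n + 1) = c n + 2 := by
    intro n hn
    have h1 : {k | μ k ≤ ((n + 1 : ℕ) : ℝ) ^ 2} = {k | μ k ≤ (n : ℝ) ^ 2} ∪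
        {k | (n : ℝ) ^ 2 < μ k ∧ μ k ≤ ((n : ℝ) + 1) ^ 2} := by
      ext k
      simp only [Set.mem_ofPred_eq, Set.mem_union, Nat.cast_add, Nat.cast_one]
      constructor
      · intro h
        rcases le_or_gt (μ k) ((n : ℝ) ^ 2) with h2 | h2
        · exact Or.inl h2
        · exact Or.inr ⟨h2, h⟩
      · rintro (h | h)
        · exact h.trans (by gcongr; linarith)
        · exact h.2
    have hdisj : Disjoint {k | μ k ≤ (n : ℝ) ^ 2}
        {k | (n : ℝ) ^ 2 < μ k ∧ μ k ≤ ((n : ℝ) + 1) ^ 2} :=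
      Set.disjoint_left.2 fun k h1 h2 => absurd h1 (not_le.2 h2.1)
    simp only [c]
    rw [h1, Set.ncard_union_eq hdisj (hfin _) ((hfin _).subset fun k hk => hk.2), hcard n hn]
  have hcN : ∀ t, c (N + t) = c N + 2 * t := by
    intro t
    induction t with
    | zero => simp
    | succ t ih => rw [← add_assoc, hstep _ (by omega), ih]; ring
  have hiff : ∀ (t : ℕ) (k : ℕ+), ((k : ℕ) = c N + 2 * t + 1 ∨ (k : ℕ) = c N + 2 * t + 2) →
      ((N + t : ℕ) : ℝ) ^ 2 < μ k ∧ μ k ≤ (((N + t : ℕ) : ℝ) + 1) ^ 2 := by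
    intro t k hk
    constructor
    · rw [← not_le, ← hc, hcN]
      omega
    · have := hc (N + t + 1) k
      rw [Nat.cast_add_one] at this
      rw [← this, add_assoc, hcN]
      omega
  -- The condition `|j| ≥ N + 1` admits `-1 - N` but not `N`, so the first eigenvalue of window `N`
  -- is left out; hence the offset `c N + 1`.
  let f : {j : ℤ // ((N + 1 : ℕ) : ℤ) ≤ |j|} → {k : ℕ+ // c N + 1 < (k : ℕ)} := fun j =>
    ⟨⟨c N + 2 * (foldIndex j - N) + (if 0 ≤ (j : ℤ) then 1 else 2), by split_ifs <;> omega⟩, by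
      have := le_abs.1 j.2
      simp only [PNat.mk_coe, foldIndex]
      split_ifs <;> omega⟩
  have hf : Function.Bijective f := by
    constructor
    · rintro ⟨i, hi⟩ ⟨j, hj⟩ h
      rw [le_abs] at hi hj
      have h1 := congrArg (fun k : {k : ℕ+ // c N + 1 < (k : ℕ)} => ((k : ℕ+) : ℕ)) h
      simp only [f, PNat.mk_coe, foldIndex] at h1
      refine Subtype.ext ?_
      simp only
      split_ifs at h1 <;> omega
    · rintro ⟨k, hk⟩
      obtain ⟨t, ht⟩ : ∃ t, (k : ℕ) = c N + 2 + t := ⟨k - (c N + 2), by omega⟩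
      rcases Nat.even_or_odd' t with ⟨s, rfl | rfl⟩
      · refine ⟨⟨-1 - (N + s : ℕ), le_abs.2 (by omega)⟩, ?_⟩
        refine Subtype.ext (PNat.eq ?_)
        simp only [f, PNat.mk_coe, foldIndex]
        split_ifs <;> omega
      · refine ⟨⟨(N + s + 1 : ℕ), le_abs.2 (by omega)⟩, ?_⟩
        refine Subtype.ext (PNat.eq ?_)
        simp only [f, PNat.mk_coe, foldIndex]
        split_ifs <;> omega
  refine ⟨c N + 1, Equiv.ofBijective f hf, fun j => ?_⟩
  have hj : N ≤ foldIndex j := by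
    have := le_abs.1 j.2
    unfold foldIndex; split_ifs <;> omega
  have := hiff (foldIndex j - N) (f j) (by
    simp only [f, PNat.mk_coe]
    split_ifs <;> omega)
  rwa [Nat.add_sub_cancel' hj] at this

/-! ### Eigenvectors in a window: tail bounds and first-order estimates. -/

/-- Compare `(m + 1/2)²` with the nearer end of the window and factor the difference of squares: one
factor is at least `t - 1/2 ≥ t/2`, the other at least `n`. -/
theorem halfIntSq_gap {n m : ℤ} {lam : ℝ} (hn : 1 ≤ n) (h1 : (n : ℝ) ^ 2 < lam)
    (h2 : lam ≤ ((n : ℝ) + 1) ^ 2) (hm : m ≠ n) (hm' : m ≠ -1 - n) :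
    ∃ t : ℝ, 1 ≤ t ∧ (t = |(m : ℝ) - n| ∨ t = |(m : ℝ) + 1 + n|) ∧
      n * t / 2 ≤ |halfIntSq m - lam| := by
  have hn : (1 : ℝ) ≤ n := by exact_mod_cast hn
  unfold halfIntSq
  have hcases : n + 1 ≤ m ∨ (0 ≤ m ∧ m ≤ n - 1) ∨ (-n ≤ m ∧ m ≤ -1) ∨ m ≤ -2 - n := by omega
  rcases hcases with h3 | ⟨h3, h4⟩ | ⟨h3, h4⟩ | h3
  · have h3 : (n : ℝ) + 1 ≤ m := by exact_mod_cast h3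
    refine ⟨m - n, by linarith, Or.inl (abs_of_nonneg (by linarith)).symm, le_abs.2 (Or.inl ?_)⟩
    nlinarith
  · have h3 : (0 : ℝ) ≤ m := by exact_mod_cast h3
    have h4 : (m : ℝ) ≤ n - 1 := by exact_mod_cast h4
    refine ⟨n - m, by linarith, Or.inl ?_, le_abs.2 (Or.inr ?_)⟩
    · rw [abs_sub_comm, abs_of_nonneg (by linarith)]
    · nlinarith
  · have h3 : (-n : ℝ) ≤ m := by exact_mod_cast h3
    have h4 : (m : ℝ) ≤ -1 := by exact_mod_cast h4
    refine ⟨m + 1 + n, by linarith, Or.inr (abs_of_nonneg (by linarith)).symm,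
      le_abs.2 (Or.inr ?_)⟩
    nlinarith
  · have h3 : (m : ℝ) ≤ -2 - n := by exact_mod_cast h3
    refine ⟨-(m + 1 + n), by linarith, Or.inr ?_, le_abs.2 (Or.inl ?_)⟩
    · rw [abs_of_nonpos (by linarith)]
    · nlinarith

/-- The sum `∑ 1 / m²` over the nonzero integers. -/
def sumInvSq : ℝ := ∑' m : ℤ, 1 / (m : ℝ) ^ 2

theorem hasSum_inv_sq_shift (k : ℤ) : HasSum (fun m : ℤ => 1 / ((m : ℝ) + k) ^ 2) sumInvSq := by
  have h : Summable fun m : ℤ => 1 / (m : ℝ) ^ 2 := by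
    simpa using (Real.summable_one_div_int_add_rpow 0 2).2 (by norm_num)
  have := (Equiv.addRight k).hasSum_iff.2 h.hasSum
  simpa [Function.comp_def, sumInvSq] using this

theorem hasSum_ite_or {ι E : Type*} [DecidableEq ι] [AddCommMonoid E] [TopologicalSpace E]
    (f : ι → E) {i j : ι} (hij : i ≠ j) :
    HasSum (fun m => if m = i ∨ m = j then f m else 0) (f i + f j) := by
  have h : ∀ m ∉ ({i, j} : Finset ι), (if m = i ∨ m = j then f m else 0) = 0 := fun m hm =>
    if_neg (by simpa using hm)
  have h2 : HasSum (fun m => if m = i ∨ m = j then f m else 0) _ := hasSum_sum_of_ne_finset_zero h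
  rw [Finset.sum_pair hij] at h2
  simpa using h2

namespace HilbertBasis

variable {H : Type u} [NormedAddCommGroup H] [InnerProductSpace ℂ H]
  {V : H →L[ℂ] H} {b : HilbertBasis ℤ ℂ H} {lam : ℝ} {x : H} {n : ℤ}

/-- The coefficients of `x` outside the modes `n` and `-1 - n`. -/
def tailCoeff (b : HilbertBasis ℤ ℂ H) (x : H) (n m : ℤ) : ℂ :=
  if m = n ∨ m = -1 - n then 0 else ⟪b m, x⟫_ℂ

/-- The eigenvalue equation and the gap give `n |x_m| ≤ 2 |(Vx)_m| / t`. Splitting the product as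
`|(Vx)_m|² + 1/t²` makes both parts summable over `m`, so that the tail is controlled in `ℓ¹` and
not only in `ℓ²`. -/
theorem norm_tailCoeff_le (hx : x ∈ b.diagAddEigenspace halfIntSq V lam) (hn : 1 ≤ n)
    (h1 : (n : ℝ) ^ 2 < lam) (h2 : lam ≤ ((n : ℝ) + 1) ^ 2) (m : ℤ) :
    ‖b.tailCoeff x n m‖ ≤ (n : ℝ)⁻¹ * (‖⟪b m, V x⟫_ℂ‖ ^ 2 +
      (1 / ((m : ℝ) + (-n : ℤ)) ^ 2 + 1 / ((m : ℝ) + (1 + n : ℤ)) ^ 2)) := by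
  have hn0 : (0 : ℝ) < n := by exact_mod_cast hn
  unfold tailCoeff
  split_ifs with hm
  · rw [norm_zero]
    positivity
  rw [not_or] at hm
  obtain ⟨t, ht1, ht, hgap⟩ := halfIntSq_gap hn h1 h2 hm.1 hm.2
  have ht2 : 1 / t ^ 2 ≤ 1 / ((m : ℝ) + (-n : ℤ)) ^ 2 + 1 / ((m : ℝ) + (1 + n : ℤ)) ^ 2 := by
    push_cast
    rcases ht with ht | ht
    · rw [ht, sq_abs, ← sub_eq_add_neg]
      exact le_add_of_nonneg_right (by positivity)
    · rw [ht, sq_abs, ← add_assoc]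
      exact le_add_of_nonneg_left (by positivity)
  have h3 : |halfIntSq m - lam| * ‖⟪b m, x⟫_ℂ‖ = ‖⟪b m, V x⟫_ℂ‖ := by
    rw [← Real.norm_eq_abs, ← Complex.norm_real, ← norm_mul, ← norm_neg ⟪b m, V x⟫_ℂ]
    congr 1
    push_cast
    linear_combination hx m
  set X := ‖⟪b m, V x⟫_ℂ‖
  set Y := ‖⟪b m, x⟫_ℂ‖
  have hY : 0 ≤ Y := norm_nonneg _
  have h4 : n * t / 2 * Y ≤ X := by
    rw [← h3]; gcongr
  have h5 : n * Y ≤ X ^ 2 + 1 / t ^ 2 := by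
    have h6 : n * Y ≤ 2 * X * (1 / t) := by
      rw [mul_one_div, le_div_iff₀ (by linarith)]
      linarith
    have h7 : (1 / t) ^ 2 = 1 / t ^ 2 := by rw [div_pow, one_pow]
    rw [← h7]
    nlinarith [sq_nonneg (X - 1 / t)]
  calc Y = (n : ℝ)⁻¹ * (n * Y) := by field_simp
    _ ≤ (n : ℝ)⁻¹ * (X ^ 2 + 1 / t ^ 2) := by gcongr
    _ ≤ _ := by gcongr

theorem tailCoeff_bound (hx : x ∈ b.diagAddEigenspace halfIntSq V lam) (hx1 : ‖x‖ = 1)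
    (hn : 1 ≤ n) (h1 : (n : ℝ) ^ 2 < lam) (h2 : lam ≤ ((n : ℝ) + 1) ^ 2) :
    Summable (fun m => ‖b.tailCoeff x n m‖) ∧
      ∑' m, ‖b.tailCoeff x n m‖ ≤ (‖V‖ ^ 2 + 2 * sumInvSq) / n := by
  have hn0 : (0 : ℝ) < n := by exact_mod_cast hn
  have hs := ((b.hasSum_sq_norm_inner (V x)).add
    ((hasSum_inv_sq_shift (-n)).add (hasSum_inv_sq_shift (1 + n)))).mul_left (n : ℝ)⁻¹
  have hle := norm_tailCoeff_le hx hn h1 h2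
  have hsum := Summable.of_nonneg_of_le (fun _ => norm_nonneg _) hle hs.summable
  refine ⟨hsum, (hasSum_le hle hsum.hasSum hs).trans ?_⟩
  rw [div_eq_inv_mul]
  have : ‖V x‖ ≤ ‖V‖ := by simpa [hx1] using V.le_opNorm x
  gcongr ?_ * (?_ ^ 2 + ?_)
  linarith

theorem hasSum_tailCoeff :
    HasSum (fun m => b.tailCoeff x n m • b m)
      (x - (⟪b n, x⟫_ℂ • b n + ⟪b (-1 - n), x⟫_ℂ • b (-1 - n))) := by
  have h1 := b.hasSum_repr x
  have hne : n ≠ -1 - n := by omega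
  have h2 := hasSum_ite_or (fun m => ⟪b m, x⟫_ℂ • b m) hne
  convert! h1.sub h2 using 1
  ext m
  simp only [tailCoeff, b.repr_apply_apply]
  split_ifs <;> simp

/-- Write `x = c b_n + c̄ b_{-1-n} + q` with `‖q‖ ≤ τ`. Pythagoras gives `2|c|² = 1 - ‖q‖²`, and the
`n`-th row gives `(λ - β - d_n) c = c̄ ⟪b_n, V b_{-1-n}⟫ + ⟪b_n, V q⟫`. -/
theorem eigenvector_estimates [CompleteSpace H] {β C₁ : ℝ}
    (hx : x ∈ b.diagAddEigenspace halfIntSq V lam) (hx1 : ‖x‖ = 1)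
    (hconj : ⟪b (-1 - n), x⟫_ℂ = starRingEnd ℂ ⟪b n, x⟫_ℂ)
    (hn : 1 ≤ n) (h1 : (n : ℝ) ^ 2 < lam) (h2 : lam ≤ ((n : ℝ) + 1) ^ 2)
    (hlarge : 2 * (‖V‖ ^ 2 + 2 * sumInvSq) ≤ n)
    (hdiag : ⟪b n, V (b n)⟫_ℂ = β) (hoff : ‖⟪b n, V (b (-1 - n))⟫_ℂ‖ ≤ C₁ / n) :
    |Real.sqrt 2 * ‖⟪b n, x⟫_ℂ‖ - 1| ≤ (‖V‖ ^ 2 + 2 * sumInvSq) / n ∧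
    |lam - (β + halfIntSq n)| ≤ (C₁ + 2 * ‖V‖ * (‖V‖ ^ 2 + 2 * sumInvSq)) / n := by
  have hn0 : (0 : ℝ) < n := by exact_mod_cast hn
  obtain ⟨hsum, hle⟩ := tailCoeff_bound hx hx1 hn h1 h2
  set τ := (‖V‖ ^ 2 + 2 * sumInvSq) / n with hτ
  set c := ⟪b n, x⟫_ℂ with hc
  set q := x - (c • b n + ⟪b (-1 - n), x⟫_ℂ • b (-1 - n)) with hq
  have hne : n ≠ -1 - n := by omega
  have hqs : HasSum (fun m => b.tailCoeff x n m • b m) q := hasSum_tailCoeff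
  have hnorm : ∀ m, ‖b.tailCoeff x n m • b m‖ = ‖b.tailCoeff x n m‖ := fun m => by
    rw [norm_smul, b.orthonormal.1 m, mul_one]
  have hqτ : ‖q‖ ≤ τ := by
    rw [← hqs.tsum_eq]
    refine (norm_tsum_le_tsum_norm (by simpa only [hnorm] using hsum)).trans ?_
    simpa only [hnorm] using hle
  have hτhalf : τ ≤ 1 / 2 := by
    rw [hτ, div_le_iff₀ hn0]; linarith
  have hb := orthonormal_iff_ite.1 b.orthonormal
  have hq2 : ‖q‖ ^ 2 = 1 - 2 * ‖c‖ ^ 2 := by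
    have hs1 := b.hasSum_sq_norm_inner x
    rw [hx1, one_pow] at hs1
    have hs2 := hasSum_ite_or (fun m => ‖⟪b m, x⟫_ℂ‖ ^ 2) hne
    rw [hconj, RCLike.norm_conj, ← hc, ← two_mul] at hs2
    refine (b.hasSum_sq_norm_inner q).unique ?_
    convert! hs1.sub hs2 using 1
    ext m
    rw [hq, inner_sub_right, inner_add_right, inner_smul_right, inner_smul_right, hb, hb]
    by_cases hm : m = n
    · subst hm; simp [hne, hc]
    · by_cases hm' : m = -1 - n
      · subst hm'; simp [Ne.symm hne]
      · simp [hm, hm']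
  have hτ0 : 0 ≤ τ := (norm_nonneg q).trans hqτ
  have hc0 := norm_nonneg c
  have hqle : ‖q‖ ^ 2 ≤ τ / 2 := by nlinarith [norm_nonneg q]
  constructor
  · set y := Real.sqrt 2 * ‖c‖ with hy
    have hy0 : 0 ≤ y := by positivity
    have hy2 : 1 - y ^ 2 = ‖q‖ ^ 2 := by
      rw [hy, mul_pow, Real.sq_sqrt (by norm_num)]; linarith
    rw [abs_le]
    constructor <;> nlinarith [sq_nonneg ‖q‖]
  -- A lower bound on `|c|` allows division of the row equation by it; it holds because `hlarge`
  -- forces `τ ≤ 1/2`.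
  · have hchalf : 1 / 2 ≤ ‖c‖ := by
      by_contra! h
      nlinarith
    have hxq : x = c • b n + ⟪b (-1 - n), x⟫_ℂ • b (-1 - n) + q := by rw [hq]; abel
    have hVx : ⟪b n, V x⟫_ℂ = c * β + starRingEnd ℂ c * ⟪b n, V (b (-1 - n))⟫_ℂ + ⟪b n, V q⟫_ℂ := by
      conv_lhs => rw [hxq]
      rw [map_add, map_add, map_smul, map_smul, inner_add_right, inner_add_right,
        inner_smul_right, inner_smul_right, hdiag, hconj]
    have heq : ((lam - (β + halfIntSq n) : ℝ) : ℂ) * c =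
        starRingEnd ℂ c * ⟪b n, V (b (-1 - n))⟫_ℂ + ⟪b n, V q⟫_ℂ := by
      have := hx n
      rw [hVx] at this
      push_cast
      linear_combination -this
    have h3 : |lam - (β + halfIntSq n)| * ‖c‖ ≤ ‖c‖ * (C₁ / n) + ‖V‖ * τ := by
      rw [← Real.norm_eq_abs, ← Complex.norm_real, ← norm_mul, heq]
      refine (norm_add_le _ _).trans (add_le_add ?_ ?_)
      · rw [norm_mul, RCLike.norm_conj]
        gcongr
      · refine (norm_inner_le_norm _ _).trans ?_
        rw [b.orthonormal.1 n, one_mul]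
        exact (V.le_opNorm q).trans (by gcongr)
    have h4 : ‖V‖ * τ ≤ ‖c‖ * (2 * ‖V‖ * τ) := by
      nlinarith [mul_nonneg (norm_nonneg V) hτ0]
    have h5 : ‖c‖ * |lam - (β + halfIntSq n)| ≤ ‖c‖ * (C₁ / n + 2 * ‖V‖ * τ) := by linarith
    have h6 := le_of_mul_le_mul_left h5 (by linarith)
    refine h6.trans_eq ?_
    rw [hτ]; ring

/-- With `J` the antilinear involution given on coefficients by `hJ`, the vector `x + J x` is fixed
by `J`; if it vanishes, then `J x = -x` and `i x` is fixed instead. -/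
theorem exists_conj_symm_eigenvector {z : ℂ}
    (hJ : ∀ x ∈ b.diagAddEigenspace halfIntSq V z, ∃ y ∈ b.diagAddEigenspace halfIntSq V z,
      ∀ m, ⟪b m, y⟫_ℂ = starRingEnd ℂ ⟪b (-1 - m), x⟫_ℂ)
    (hx : x ∈ b.diagAddEigenspace halfIntSq V z) (hx0 : x ≠ 0) :
    ∃ y ∈ b.diagAddEigenspace halfIntSq V z, ‖y‖ = 1 ∧
      ∀ m, ⟪b (-1 - m), y⟫_ℂ = starRingEnd ℂ ⟪b m, y⟫_ℂ := by
  suffices h : ∃ y ∈ b.diagAddEigenspace halfIntSq V z, y ≠ 0 ∧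
      ∀ m, ⟪b (-1 - m), y⟫_ℂ = starRingEnd ℂ ⟪b m, y⟫_ℂ by
    obtain ⟨y, hy, hy0, hs⟩ := h
    refine ⟨((‖y‖⁻¹ : ℝ) : ℂ) • y, Submodule.smul_mem _ _ hy, ?_, fun m => ?_⟩
    · rw [norm_smul, Complex.norm_real, norm_inv, norm_norm, inv_mul_cancel₀ (norm_ne_zero_iff.2 hy0)]
    · rw [inner_smul_right, inner_smul_right, map_mul, Complex.conj_ofReal, hs]
  obtain ⟨x', hx', hs⟩ := hJ x hx
  by_cases h0 : x + x' = 0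
  · refine ⟨Complex.I • x, Submodule.smul_mem _ _ hx, by simpa using hx0, fun m => ?_⟩
    have h1 := congrArg (fun v => ⟪b (-1 - m), v⟫_ℂ) h0
    simp only [inner_add_right, inner_zero_right, hs] at h1
    rw [show -1 - (-1 - m) = m by ring] at h1
    rw [inner_smul_right, inner_smul_right, map_mul, Complex.conj_I]
    linear_combination Complex.I * h1
  · refine ⟨x + x', Submodule.add_mem _ hx hx', h0, fun m => ?_⟩
    rw [inner_add_right, inner_add_right, hs, hs, show -1 - (-1 - m) = m by ring, map_add,
      Complex.conj_conj]
    ring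

end HilbertBasis

/-! ### Absolutely continuous complex-valued functions. -/

theorem AbsolutelyContinuousOnInterval.lipschitz_comp {X Y : Type*} [PseudoMetricSpace X]
    [PseudoMetricSpace Y] {f : ℝ → X} {g : X → Y} {a b : ℝ} (hg : ∀ x y, dist (g x) (g y) ≤ dist x y)
    (hf : AbsolutelyContinuousOnInterval f a b) :
    AbsolutelyContinuousOnInterval (fun x => g (f x)) a b :=
  squeeze_zero (fun _ => Finset.sum_nonneg fun _ _ => dist_nonneg)
    (fun _ => Finset.sum_le_sum fun _ _ => hg _ _) hf

theorem AbsolutelyContinuousOnInterval.integral_eq_sub_of_ae_hasDerivAt {W w : ℝ → ℂ} {a b : ℝ}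
    (hW : AbsolutelyContinuousOnInterval W a b)
    (hd : ∀ᵐ x, x ∈ Set.uIcc a b → HasDerivAt W (w x) x)
    (hw : IntervalIntegrable w volume a b) : ∫ x in a..b, w x = W b - W a := by
  have key : ∀ L : ℂ →L[ℝ] ℝ, (∀ z, |L z| ≤ ‖z‖) → L (∫ x in a..b, w x) = L (W b - W a) := by
    intro L hL
    have hac : AbsolutelyContinuousOnInterval (fun x => L (W x)) a b :=
      hW.lipschitz_comp fun x y => by
        rw [dist_eq_norm, dist_eq_norm, ← map_sub]; exact hL _
    rw [map_sub, ← hac.integral_deriv_eq_sub, ← L.intervalIntegral_comp_comm hw]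
    refine intervalIntegral.integral_congr_ae ?_
    filter_upwards [hd] with x hx hx2
    exact (L.hasFDerivAt.comp_hasDerivAt x (hx (Set.uIoc_subset_uIcc hx2))).deriv.symm
  exact Complex.ext (key Complex.reCLM Complex.abs_re_le_norm)
    (key Complex.imCLM Complex.abs_im_le_norm)

/-! ### The gauge modes: periodicity and weak derivative. -/

namespace CircleMagnetic

theorem integral_arc {E : Type*} [NormedAddCommGroup E] [NormedSpace ℝ E] (f : ℝ → E) :
    ∫ θ, f θ ∂arc = ∫ θ in (0 : ℝ)..(2 * Real.pi), f θ := by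
  rw [intervalIntegral.integral_of_le Real.two_pi_pos.le, arc]

theorem _root_.MeasureTheory.MemLp.intervalIntegrable_arc {E : Type*} [NormedAddCommGroup E] {f : ℝ → E}
    {p : ENNReal} (hp : 1 ≤ p) (hf : MemLp f p arc) :
    IntervalIntegrable f volume 0 (2 * Real.pi) := by
  rw [intervalIntegrable_iff_integrableOn_Ioc_of_le Real.two_pi_pos.le]
  exact hf.integrable hp

theorem _root_.MeasureTheory.MemLp.mul_memLp_top {f g : ℝ → ℂ}
    (hf : MemLp f ⊤ arc) (hg : MemLp g 2 arc) : MemLp (fun θ => f θ * g θ) 2 arc :=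
  hg.mul hf

theorem _root_.Continuous.memLp_arc {f : ℝ → ℂ} (hf : Continuous f) {p : ENNReal} :
    MemLp f p arc := by
  obtain ⟨C, hC⟩ := (isCompact_Icc (a := (0 : ℝ)) (b := 2 * Real.pi)).exists_bound_of_continuousOn
    hf.continuousOn
  refine MemLp.of_bound hf.aestronglyMeasurable C ?_
  refine (ae_restrict_iff' measurableSet_Ioc).2 (ae_of_all _ fun θ hθ => ?_)
  exact hC θ (Set.Ioc_subset_Icc_self hθ)

/-- The potentials considered here: bounded and periodic, with mean value in `ℤ + 1/2`. -/
structure HalfFlux (A : ℝ → ℝ) : Prop where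
  periodic : Function.Periodic A (2 * Real.pi)
  memLp : MemLp A ⊤ arc
  flux : ∃ m : ℤ, circleMean A = (m : ℝ) + 1 / 2

/-- The phase of the `m`-th eigenfunction of `-i d/dθ + A`. -/
def gaugePhase (A : ℝ → ℝ) (m : ℤ) (θ : ℝ) : ℝ := ((m : ℝ) + 1 / 2) * θ - ∫ t in (0 : ℝ)..θ, A t

/-- The normalized eigenfunction of `-i d/dθ + A` with eigenvalue `m + 1/2`. -/
def gaugeMode (A : ℝ → ℝ) (m : ℤ) (θ : ℝ) : ℂ :=
  ((Real.sqrt (2 * Real.pi))⁻¹ : ℝ) * Complex.exp (Complex.I * (gaugePhase A m θ : ℝ))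

theorem norm_gaugeMode (A : ℝ → ℝ) (m : ℤ) (θ : ℝ) :
    ‖gaugeMode A m θ‖ = (Real.sqrt (2 * Real.pi))⁻¹ := by
  rw [gaugeMode, norm_mul, Complex.norm_exp_I_mul_ofReal, mul_one, Complex.norm_real,
    Real.norm_of_nonneg (by positivity)]

namespace HalfFlux

variable {A : ℝ → ℝ}

theorem intervalIntegrable (hA : HalfFlux A) (x y : ℝ) : IntervalIntegrable A volume x y :=
  hA.periodic.intervalIntegrable₀ Real.two_pi_pos.ne'
    (hA.memLp.intervalIntegrable_arc le_top) x y

theorem memLp_ofReal (hA : HalfFlux A) : MemLp (fun θ => (A θ : ℂ)) ⊤ arc := hA.memLp.ofReal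

theorem continuous_gaugeMode (hA : HalfFlux A) (m : ℤ) : Continuous (gaugeMode A m) := by
  have h : Continuous fun θ => ∫ t in (0 : ℝ)..θ, A t :=
    intervalIntegral.continuous_primitive hA.intervalIntegrable 0
  unfold gaugeMode gaugePhase
  fun_prop

/-- The half-integer flux enters here: over one period the phase grows by `2π(m + 1/2) - 2π(k +
1/2)`, an integer multiple of `2π`. -/
theorem periodic_gaugeMode (hA : HalfFlux A) (m : ℤ) :
    Function.Periodic (gaugeMode A m) (2 * Real.pi) := by
  intro θ
  obtain ⟨k, hk⟩ := hA.flux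
  have h1 : ∫ t in (0 : ℝ)..(2 * Real.pi), A t = 2 * Real.pi * (k + 1 / 2) := by
    rw [← hk, circleMean]
    field_simp
  have h2 : ∫ t in (0 : ℝ)..(θ + 2 * Real.pi), A t =
      (∫ t in (0 : ℝ)..θ, A t) + 2 * Real.pi * (k + 1 / 2) := by
    rw [← intervalIntegral.integral_add_adjacent_intervals (hA.intervalIntegrable 0 θ)
      (hA.intervalIntegrable θ _), hA.periodic.intervalIntegral_add_eq θ 0, zero_add, h1]
  have h3 : gaugePhase A m (θ + 2 * Real.pi) = gaugePhase A m θ + (m - k : ℤ) * (2 * Real.pi) := by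
    rw [gaugePhase, gaugePhase, h2]
    push_cast
    ring
  rw [gaugeMode, gaugeMode, h3, Complex.exp_eq_exp_iff_exists_int.2 ⟨m - k, ?_⟩]
  push_cast
  ring

/-- The phase is absolutely continuous as a primitive, and `x ↦ e^{ix}` is 1-Lipschitz. -/
theorem absolutelyContinuous_gaugeMode (hA : HalfFlux A) (m : ℤ) :
    AbsolutelyContinuousOnInterval (gaugeMode A m) 0 (2 * Real.pi) := by
  have h1 : AbsolutelyContinuousOnInterval (gaugePhase A m) 0 (2 * Real.pi) := by
    refine AbsolutelyContinuousOnInterval.fun_sub ?_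
      ((hA.intervalIntegrable _ _).absolutelyContinuousOnInterval_intervalIntegral (by simp))
    exact ContDiffOn.absolutelyContinuousOnInterval (by fun_prop)
  refine AbsolutelyContinuousOnInterval.const_smul (M := ℂ) _
    (h1.lipschitz_comp (g := fun x : ℝ => Complex.exp (Complex.I * (x : ℂ))) fun x y => ?_)
  have h2 : Complex.exp (Complex.I * (x : ℂ)) - Complex.exp (Complex.I * (y : ℂ)) =
      Complex.exp (Complex.I * (y : ℂ)) * (Complex.exp (Complex.I * ((x - y : ℝ) : ℂ)) - 1) := by
    rw [mul_sub, ← Complex.exp_add, mul_one]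
    congr 2
    push_cast
    ring
  rw [dist_eq_norm, dist_eq_norm, h2, norm_mul, Complex.norm_exp_I_mul_ofReal, one_mul]
  exact Real.norm_exp_I_mul_ofReal_sub_one_le

theorem ae_hasDerivAt_gaugeMode (hA : HalfFlux A) (m : ℤ) :
    ∀ᵐ θ, θ ∈ Set.uIcc 0 (2 * Real.pi) → HasDerivAt (gaugeMode A m)
      (Complex.I * ((m : ℂ) + 1 / 2 - A θ) * gaugeMode A m θ) θ := by
  filter_upwards [(hA.intervalIntegrable 0 (2 * Real.pi)).ae_hasDerivAt_integral] with θ hθ hmem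
  have h1 : HasDerivAt (gaugePhase A m) (((m : ℝ) + 1 / 2) * 1 - A θ) θ :=
    ((hasDerivAt_id θ).const_mul _).sub (hθ hmem 0 (by simp))
  have h2 := ((h1.ofReal_comp.const_mul Complex.I).cexp).const_mul
    (((Real.sqrt (2 * Real.pi))⁻¹ : ℝ) : ℂ)
  convert! h2 using 1
  rw [gaugeMode]
  push_cast
  ring

theorem memLp_deriv_gaugeMode (hA : HalfFlux A) (m : ℤ) :
    MemLp (fun θ => Complex.I * ((m : ℂ) + 1 / 2 - A θ) * gaugeMode A m θ) 2 arc := by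
  have h1 : MemLp (fun θ => Complex.I * ((m : ℂ) + 1 / 2 - A θ)) ⊤ arc :=
    ((memLp_const ((m : ℂ) + 1 / 2)).sub hA.memLp_ofReal).const_mul Complex.I
  exact h1.mul_memLp_top (hA.continuous_gaugeMode m).memLp_arc

/-- The mode `gaugeMode A m` is in `H¹`, with the expected derivative. -/
theorem hasH1Deriv_gaugeMode (hA : HalfFlux A) (m : ℤ) :
    HasH1Deriv (gaugeMode A m)
      (fun θ => Complex.I * ((m : ℂ) + 1 / 2 - A θ) * gaugeMode A m θ) := by
  have hc := hA.continuous_gaugeMode m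
  refine ⟨hc.memLp_arc, hA.memLp_deriv_gaugeMode m, fun η hη hper => ?_⟩
  have hη1 : ContDiff ℝ 1 η := hη.of_le (by exact_mod_cast le_top)
  have hη' : Continuous (deriv η) := hη1.continuous_deriv le_rfl
  have hac : AbsolutelyContinuousOnInterval (fun θ => gaugeMode A m θ * η θ) 0 (2 * Real.pi) :=
    (hA.absolutelyContinuous_gaugeMode m).fun_smul hη1.contDiffOn.absolutelyContinuousOnInterval
  have hi1 : Integrable (fun θ => gaugeMode A m θ * deriv η θ) arc :=
    HasWeakDeriv.integrable_mul hc.memLp_arc hη'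
  have hi2 := HasWeakDeriv.integrable_mul (hA.memLp_deriv_gaugeMode m) hη1.continuous
  have hint := hac.integral_eq_sub_of_ae_hasDerivAt
    (w := fun θ => Complex.I * ((m : ℂ) + 1 / 2 - A θ) * gaugeMode A m θ * η θ +
      gaugeMode A m θ * deriv η θ) (by
    filter_upwards [hA.ae_hasDerivAt_gaugeMode m] with θ hθ hmem
    exact (hθ hmem).mul (hη1.differentiable one_ne_zero θ).hasDerivAt) (by
    rw [intervalIntegrable_iff_integrableOn_Ioc_of_le Real.two_pi_pos.le]
    exact hi2.add hi1)
  have h0 : gaugeMode A m (2 * Real.pi) * η (2 * Real.pi) = gaugeMode A m 0 * η 0 := by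
    have h1 := hA.periodic_gaugeMode m 0
    have h2 := hper 0
    rw [zero_add] at h1 h2
    rw [h1, h2]
  rw [h0, sub_self, ← integral_arc, integral_add hi2 hi1] at hint
  linear_combination hint

end HalfFlux

/-- For this constant potential the modes are the plain exponentials `e^{imθ}/√(2π)`, which are
admissible test functions. -/
theorem halfFlux_half : HalfFlux (fun _ => 1 / 2) := by
  refine ⟨fun _ => rfl, memLp_const _, 0, ?_⟩
  rw [circleMean, intervalIntegral.integral_const]
  have := Real.pi_pos
  simp
  field_simp

theorem HasH1Deriv.conj {f g : ℝ → ℂ} (h : HasH1Deriv f g) :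
    HasH1Deriv (fun θ => conj (f θ)) (fun θ => conj (g θ)) := by
  refine ⟨h.memLp.star, h.memLp_deriv.star, fun η hη hper => ?_⟩
  have h1 : ContDiff ℝ (⊤ : ℕ∞) (fun θ => conj (η θ)) := Complex.conjCLE.contDiff.comp hη
  have h2 : ∀ θ, deriv (fun θ => conj (η θ)) θ = conj (deriv η θ) := fun θ =>
    (Complex.conjCLE.hasFDerivAt.comp_hasDerivAt θ
      ((hη.differentiable (by simp)) θ).hasDerivAt).deriv
  have h3 := congrArg conj (h.weakDeriv _ h1 fun θ => by simp [hper θ])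
  simp only [h2] at h3
  rw [← integral_conj, map_neg, ← integral_conj] at h3
  simpa using h3

end CircleMagnetic

/-! ### Completeness of the gauge modes and integration by parts in `H¹`. -/

namespace CircleMagnetic

/-- The `m`-th coefficient of `f` with respect to the modes `gaugeMode A`. -/
def gaugeCoeff (A : ℝ → ℝ) (m : ℤ) (f : ℝ → ℂ) : ℂ := ∫ θ, conj (gaugeMode A m θ) * f θ ∂arc

theorem inner_toLp {f g : ℝ → ℂ} (hf : MemLp f 2 arc) (hg : MemLp g 2 arc) :
    ⟪hf.toLp, hg.toLp⟫_ℂ = ∫ θ, conj (f θ) * g θ ∂arc := by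
  rw [L2.inner_def]
  refine integral_congr_ae ?_
  filter_upwards [hf.coeFn_toLp, hg.coeFn_toLp] with θ h1 h2
  rw [h1, h2, RCLike.inner_apply, mul_comm]

theorem norm_sq_eq_integral (f : Lp ℂ 2 arc) : ‖f‖ ^ 2 = ∫ θ, ‖f θ‖ ^ 2 ∂arc := by
  have h : ((‖f‖ : ℂ)) ^ 2 = ⟪f, f⟫_ℂ := (inner_self_eq_norm_sq_to_K f).symm
  rw [L2.inner_def] at h
  simp only [inner_self_eq_norm_sq_to_K] at h
  have h2 : ((∫ θ, ‖f θ‖ ^ 2 ∂arc : ℝ) : ℂ) = ∫ θ, ((‖f θ‖ : ℂ)) ^ 2 ∂arc := by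
    exact (integral_ofReal (𝕜 := ℂ) (f := fun θ => ‖f θ‖ ^ 2)).symm.trans (by simp)
  exact_mod_cast h.trans h2.symm

theorem gaugeMode_eq (A : ℝ → ℝ) (m : ℤ) (θ : ℝ) :
    gaugeMode A m θ = Complex.exp (Complex.I * m * θ) * gaugeMode A 0 θ := by
  rw [gaugeMode, gaugeMode, mul_left_comm, ← Complex.exp_add]
  congr 2
  simp only [gaugePhase]
  push_cast
  ring

theorem conj_gaugeMode_mul_gaugeMode (A : ℝ → ℝ) (m l : ℤ) (θ : ℝ) :
    conj (gaugeMode A m θ) * gaugeMode A l θ =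
      ((2 * Real.pi : ℝ) : ℂ)⁻¹ * Complex.exp (((l - m : ℤ) : ℂ) * Complex.I * θ) := by
  rw [gaugeMode, gaugeMode, map_mul, Complex.conj_ofReal, ← Complex.exp_conj, map_mul,
    Complex.conj_I, Complex.conj_ofReal, mul_mul_mul_comm, ← Complex.exp_add]
  congr 1
  · rw [← Complex.ofReal_mul, ← mul_inv, Real.mul_self_sqrt Real.two_pi_pos.le, Complex.ofReal_inv]
  · congr 1
    simp only [gaugePhase]
    push_cast
    ring

theorem integral_exp_int (k : ℤ) :
    ∫ θ, Complex.exp ((k : ℂ) * Complex.I * (θ : ℝ)) ∂arc =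
      if k = 0 then ((2 * Real.pi : ℝ) : ℂ) else 0 := by
  rw [integral_arc]
  split_ifs with hk
  · simp [hk]
  · have hk' : (k : ℂ) * Complex.I ≠ 0 := by simp [hk]
    rw [integral_exp_mul_complex hk']
    have : Complex.exp ((k : ℂ) * Complex.I * ((2 * Real.pi : ℝ) : ℂ)) = 1 := by
      rw [Complex.exp_eq_one_iff]
      exact ⟨k, by push_cast; ring⟩
    rw [this]
    simp

namespace HalfFlux

variable {A : ℝ → ℝ}

/-- `gaugeMode A m` as an element of `L²`. -/
def modeLp (hA : HalfFlux A) (m : ℤ) : Lp ℂ 2 arc :=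
  ((hA.continuous_gaugeMode m).memLp_arc (p := 2)).toLp

theorem inner_modeLp (hA : HalfFlux A) (m : ℤ) {f : ℝ → ℂ} (hf : MemLp f 2 arc) :
    ⟪hA.modeLp m, hf.toLp⟫_ℂ = gaugeCoeff A m f := inner_toLp _ hf

theorem inner_modeLp' (hA : HalfFlux A) (m : ℤ) (f : Lp ℂ 2 arc) :
    ⟪hA.modeLp m, f⟫_ℂ = gaugeCoeff A m f := by
  conv_lhs => rw [← Lp.toLp_coeFn f (Lp.memLp f)]
  exact hA.inner_modeLp m _

theorem orthonormal_modeLp (hA : HalfFlux A) : Orthonormal ℂ hA.modeLp := by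
  rw [orthonormal_iff_ite]
  intro m l
  rw [modeLp, modeLp, inner_toLp]
  simp only [conj_gaugeMode_mul_gaugeMode]
  rw [integral_const_mul, integral_exp_int]
  have hpi : ((2 * Real.pi : ℝ) : ℂ) ≠ 0 := by exact_mod_cast Real.two_pi_pos.ne'
  by_cases h : m = l
  · rw [h, sub_self, if_pos rfl, if_pos rfl, inv_mul_cancel₀ hpi]
  · have : l - m ≠ 0 := by omega
    simp [h, this]

/-- Multiplication by the conjugate of mode `0`, which has constant modulus, turns these
coefficients into ordinary Fourier coefficients, up to a constant factor; Parseval's identity for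
Fourier series then forces `f = 0`. -/
theorem orthogonal_modeLp (hA : HalfFlux A) :
    (Submodule.span ℂ (Set.range hA.modeLp))ᗮ = ⊥ := by
  rw [eq_bot_iff]
  intro f hf
  have h0 : ∀ m, gaugeCoeff A m f = 0 := fun m => by
    rw [← hA.inner_modeLp']
    exact hf _ (Submodule.subset_span ⟨m, rfl⟩)
  set g : ℝ → ℂ := fun θ => conj (gaugeMode A 0 θ) * f θ with hg
  have hgmem : MemLp g 2 arc := (hA.continuous_gaugeMode 0).memLp_arc.star.mul_memLp_top (Lp.memLp f)
  have hnorm : ∀ θ, ‖g θ‖ ^ 2 = (2 * Real.pi)⁻¹ * ‖f θ‖ ^ 2 := fun θ => by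
    rw [hg, norm_mul, RCLike.norm_conj, norm_gaugeMode, mul_pow, inv_pow,
      Real.sq_sqrt Real.two_pi_pos.le]
  have hcoef : ∀ m, fourierCoeffOn Real.two_pi_pos g m = 0 := by
    intro m
    rw [fourierCoeffOn_eq_integral, ← integral_arc]
    rw [smul_eq_zero]
    right
    have hm := h0 m
    rw [gaugeCoeff] at hm
    rw [← hm]
    refine integral_congr_ae (ae_of_all _ fun θ => ?_)
    simp only [hg, smul_eq_mul]
    rw [gaugeMode_eq A m, map_mul, fourier_coe_apply, ← Complex.exp_conj, ← mul_assoc]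
    congr 3
    simp only [map_mul, Complex.conj_I, Complex.conj_ofReal, map_intCast]
    have := Real.pi_ne_zero
    push_cast
    field_simp
    ring
  have hs := hasSum_sq_fourierCoeffOn Real.two_pi_pos (f := g) hgmem
  simp only [hcoef, norm_zero, hnorm, sub_zero] at hs
  rw [← integral_arc, integral_const_mul, ← norm_sq_eq_integral] at hs
  have h00 : HasSum (fun _ : ℤ => (0 : ℝ) ^ 2) 0 := by simp
  have hz := hs.unique h00
  have hpi := Real.pi_ne_zero
  simpa [hpi] using hz

/-- The modes `gaugeMode A m` form a Hilbert basis of `L²`. -/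
def basis (hA : HalfFlux A) : HilbertBasis ℤ ℂ (Lp ℂ 2 arc) :=
  HilbertBasis.mkOfOrthogonalEqBot hA.orthonormal_modeLp hA.orthogonal_modeLp

theorem basis_apply (hA : HalfFlux A) (m : ℤ) : hA.basis m = hA.modeLp m := by
  rw [basis, HilbertBasis.coe_mkOfOrthogonalEqBot]

theorem inner_basis (hA : HalfFlux A) (m : ℤ) (f : Lp ℂ 2 arc) :
    ⟪hA.basis m, f⟫_ℂ = gaugeCoeff A m f := by
  rw [basis_apply, inner_modeLp']

theorem inner_basis_toLp (hA : HalfFlux A) (m : ℤ) {f : ℝ → ℂ} (hf : MemLp f 2 arc) :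
    ⟪hA.basis m, hf.toLp⟫_ℂ = gaugeCoeff A m f := by
  rw [basis_apply, inner_modeLp]

/-- Parseval's identity, for the bilinear pairing of two functions. -/
theorem hasSum_integral_mul (hA : HalfFlux A) {f g : ℝ → ℂ} (hf : MemLp f 2 arc)
    (hg : MemLp g 2 arc) :
    HasSum (fun m => (∫ θ, f θ * gaugeMode A m θ ∂arc) * gaugeCoeff A m g)
      (∫ θ, f θ * g θ ∂arc) := by
  have hf' : MemLp (fun θ => conj (f θ)) 2 arc := hf.star
  have h := hA.basis.hasSum_inner_mul_inner hf'.toLp hg.toLp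
  rw [inner_toLp] at h
  simp only [basis_apply, modeLp, inner_toLp, Complex.conj_conj] at h
  exact h

end HalfFlux

/-- The definition tests weak derivatives against smooth functions only, whereas gauge modes need
not be smooth. Expanding both sides by Parseval in the exponentials `e^{imθ}`, where a derivative is
multiplication by `± i m`, closes the gap. -/
theorem HasH1Deriv.integral_mul_eq_neg {f f' h h' : ℝ → ℂ} (hf : HasH1Deriv f f')
    (hh : HasH1Deriv h h') : ∫ θ, f θ * h' θ ∂arc = -∫ θ, f' θ * h θ ∂arc := by
  have hA := halfFlux_half
  set A : ℝ → ℝ := fun _ => 1 / 2 with hAdef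
  have hphase : ∀ m θ, gaugePhase A m θ = m * θ := by
    intro m θ
    simp [gaugePhase, hAdef]
    ring
  have hsmooth : ∀ m, ContDiff ℝ (⊤ : ℕ∞) (gaugeMode A m) := by
    intro m
    unfold gaugeMode
    simp only [hphase]
    have : ContDiff ℝ (⊤ : ℕ∞) (fun θ : ℝ => (((m : ℝ) * θ : ℝ) : ℂ)) :=
      Complex.ofRealCLM.contDiff.comp (contDiff_const.mul contDiff_id)
    exact contDiff_const.mul (contDiff_const.mul this).cexp
  have hderiv : ∀ m θ, deriv (gaugeMode A m) θ = Complex.I * m * gaugeMode A m θ := by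
    intro m θ
    have h1 : HasDerivAt (gaugePhase A m) ((m : ℝ) * 1) θ := by
      rw [show gaugePhase A m = fun θ => (m : ℝ) * θ from funext (hphase m)]
      exact (hasDerivAt_id θ).const_mul _
    have h2 := ((h1.ofReal_comp.const_mul Complex.I).cexp).const_mul
      (((Real.sqrt (2 * Real.pi))⁻¹ : ℝ) : ℂ)
    refine h2.deriv.trans ?_
    rw [gaugeMode]
    push_cast
    ring
  have hconj : ∀ m, (fun θ => conj (gaugeMode A m θ)) = gaugeMode A (-m) := by
    intro m
    ext θ
    rw [gaugeMode, gaugeMode, map_mul, Complex.conj_ofReal, ← Complex.exp_conj, map_mul,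
      Complex.conj_I, Complex.conj_ofReal, hphase, hphase]
    push_cast
    ring_nf
  have key : ∀ {p p' : ℝ → ℂ}, HasH1Deriv p p' → ∀ m,
      ∫ θ, p' θ * gaugeMode A m θ ∂arc = -(Complex.I * m) * ∫ θ, p θ * gaugeMode A m θ ∂arc := by
    intro p p' hp m
    have h1 := hp.weakDeriv _ (hsmooth m) (hA.periodic_gaugeMode m)
    simp only [hderiv] at h1
    have h2 : ∫ θ, p θ * (Complex.I * m * gaugeMode A m θ) ∂arc =
        Complex.I * m * ∫ θ, p θ * gaugeMode A m θ ∂arc := by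
      rw [← integral_const_mul]
      congr 1
      ext θ
      ring
    linear_combination h1 - h2
  have key2 : ∀ {p : ℝ → ℂ} m, gaugeCoeff A m p = ∫ θ, p θ * gaugeMode A (-m) θ ∂arc := by
    intro p m
    rw [gaugeCoeff, ← hconj]
    simp only [mul_comm]
  have hs1 := hA.hasSum_integral_mul hf.memLp hh.memLp_deriv
  have hs2 := hA.hasSum_integral_mul hf.memLp_deriv hh.memLp
  refine hs1.unique ?_
  convert! hs2.neg using 1
  ext m
  rw [key2, key2, key hf, key hh]
  push_cast
  ring

end CircleMagnetic

/-! ### The operator and its eigenspaces in gauge coefficients. -/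

namespace CircleMagnetic

theorem integrable_mul_of_memLp {f g : ℝ → ℂ} (hf : MemLp f 2 arc) (hg : MemLp g 2 arc) :
    Integrable (fun θ => f θ * g θ) arc := by
  rw [← memLp_one_iff_integrable]
  exact hg.mul hf

namespace HalfFlux

variable {A : ℝ → ℝ}

theorem memLp_right (hA : HalfFlux A) {φ ψ : ℝ → ℂ} (h : MagneticDeriv A φ ψ) :
    MemLp ψ 2 arc := by
  obtain ⟨g, hg, he⟩ := h
  exact MemLp.ae_eq (EventuallyEq.symm he)
    ((hg.memLp_deriv.const_mul _).add (hA.memLp_ofReal.mul_memLp_top hg.memLp))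

theorem gaugeCoeff_of_magneticDeriv (hA : HalfFlux A) {φ ψ : ℝ → ℂ} (h : MagneticDeriv A φ ψ)
    (m : ℤ) : gaugeCoeff A m ψ = ((m : ℂ) + 1 / 2) * gaugeCoeff A m φ := by
  obtain ⟨g, hg, he⟩ := h
  have hmode := (hA.hasH1Deriv_gaugeMode m).conj
  have hparts := hg.integral_mul_eq_neg hmode
  have hAφ := hA.memLp_ofReal.mul_memLp_top hg.memLp
  have i1 := (integrable_mul_of_memLp hmode.memLp hg.memLp_deriv).const_mul (-Complex.I)
  have i2 := integrable_mul_of_memLp hmode.memLp hAφ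
  have i3 := (integrable_mul_of_memLp hmode.memLp hg.memLp).const_mul
    (-Complex.I * ((m : ℂ) + 1 / 2))
  have e1 : gaugeCoeff A m ψ = -Complex.I * (∫ θ, g θ * conj (gaugeMode A m θ) ∂arc) +
      ∫ θ, conj (gaugeMode A m θ) * (A θ * φ θ) ∂arc := by
    rw [← integral_const_mul]
    simp only [mul_comm (g _)]
    rw [← integral_add i1 i2, gaugeCoeff]
    refine integral_congr_ae ?_
    filter_upwards [he] with θ hθ
    rw [hθ]
    ring
  have e2 : ∫ θ, φ θ * conj (Complex.I * ((m : ℂ) + 1 / 2 - A θ) * gaugeMode A m θ) ∂arc =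
      -Complex.I * ((m : ℂ) + 1 / 2) * gaugeCoeff A m φ +
        Complex.I * ∫ θ, conj (gaugeMode A m θ) * (A θ * φ θ) ∂arc := by
    rw [gaugeCoeff, ← integral_const_mul, ← integral_const_mul,
      ← integral_add i3 (i2.const_mul _)]
    congr 1
    ext θ
    simp only [map_mul, map_sub, map_add, map_div₀, map_one, Complex.conj_I, Complex.conj_ofReal,
      map_intCast, map_ofNat]
    ring
  rw [e2] at hparts
  rw [e1]
  linear_combination -Complex.I * hparts + ((∫ θ, conj (gaugeMode A m θ) * (A θ * φ θ) ∂arc) -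
    ((m : ℂ) + 1 / 2) * gaugeCoeff A m φ) * Complex.I_mul_I

/-- The candidate derivative is `i(ψ - Aφ)`. Against a test function `η`, Parseval reduces the claim
to the pairings of `η'` with single modes, where the derivative can be moved onto the mode. -/
theorem magneticDeriv_of_gaugeCoeff (hA : HalfFlux A) {φ ψ : ℝ → ℂ} (hφ : MemLp φ 2 arc)
    (hψ : MemLp ψ 2 arc)
    (h : ∀ m : ℤ, gaugeCoeff A m ψ = ((m : ℂ) + 1 / 2) * gaugeCoeff A m φ) :
    MagneticDeriv A φ ψ := by
  have hAφ := hA.memLp_ofReal.mul_memLp_top hφ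
  refine ⟨fun θ => Complex.I * (ψ θ - A θ * φ θ), ⟨hφ, (hψ.sub hAφ).const_mul _, ?_⟩,
    ae_of_all _ fun θ => ?_⟩
  · intro η hη hper
    have hη2 : MemLp η 2 arc := hη.continuous.memLp_arc
    have hη' : MemLp (deriv η) 2 arc := (hη.continuous_deriv (by simp)).memLp_arc
    have hAη := hA.memLp_ofReal.mul_memLp_top hη2
    have s1 := hA.hasSum_integral_mul hη' hφ
    have s2 := hA.hasSum_integral_mul hη2 hψ
    have s3 := hA.hasSum_integral_mul hAη hφ
    have key : ∀ m, ∫ θ, deriv η θ * gaugeMode A m θ ∂arc =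
        -Complex.I * ((m : ℂ) + 1 / 2) * (∫ θ, η θ * gaugeMode A m θ ∂arc) +
        Complex.I * ∫ θ, A θ * η θ * gaugeMode A m θ ∂arc := by
      intro m
      have hmode := (hA.continuous_gaugeMode m).memLp_arc (p := 2)
      have := (hA.hasH1Deriv_gaugeMode m).weakDeriv η hη hper
      simp only [mul_comm (deriv η _)]
      rw [this, ← integral_const_mul, ← integral_const_mul, ← integral_add
        ((integrable_mul_of_memLp hη2 hmode).const_mul _)
        ((integrable_mul_of_memLp hAη hmode).const_mul _), ← integral_neg]
      congr 1
      ext θ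
      ring
    have e := s1.unique (by
      convert! (s2.mul_left (-Complex.I)).add (s3.mul_left Complex.I) using 1
      ext m
      rw [key, h]
      ring)
    calc ∫ θ, φ θ * deriv η θ ∂arc = ∫ θ, deriv η θ * φ θ ∂arc := by simp only [mul_comm]
      _ = _ := e
      _ = -∫ θ, Complex.I * (ψ θ - A θ * φ θ) * η θ ∂arc := by
        rw [← integral_const_mul, ← integral_const_mul, ← integral_add
          ((integrable_mul_of_memLp hη2 hψ).const_mul _)
          ((integrable_mul_of_memLp hAη hφ).const_mul _), ← integral_neg]
        congr 1
        ext θ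
        ring
  · linear_combination (ψ θ - A θ * φ θ) * Complex.I_mul_I

end HalfFlux

/-- Multiplication by a bounded real function, as an operator on `L²`. -/
def mulOp {a : ℝ → ℝ} (ha : MemLp a ⊤ arc) : Lp ℂ 2 arc →L[ℂ] Lp ℂ 2 arc :=
  (ContinuousLinearMap.mul ℂ ℂ).holderL arc ⊤ 2 2 (ha.ofReal (K := ℂ)).toLp

theorem coeFn_mulOp {a : ℝ → ℝ} (ha : MemLp a ⊤ arc) (f : Lp ℂ 2 arc) :
    mulOp ha f =ᵐ[arc] fun θ => a θ * f θ := by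
  have h := (ContinuousLinearMap.mul ℂ ℂ).coeFn_holder (r := 2) (ha.ofReal (K := ℂ)).toLp f
  filter_upwards [h, (ha.ofReal (K := ℂ)).coeFn_toLp] with θ h1 h2
  rw [mulOp, ContinuousLinearMap.holderL_apply_apply, h1, h2]
  rfl

theorem isSymmetric_mulOp {a : ℝ → ℝ} (ha : MemLp a ⊤ arc) :
    (mulOp ha : Lp ℂ 2 arc →ₗ[ℂ] Lp ℂ 2 arc).IsSymmetric := by
  intro f g
  change ⟪mulOp ha f, g⟫_ℂ = ⟪f, mulOp ha g⟫_ℂ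
  rw [L2.inner_def, L2.inner_def]
  refine integral_congr_ae ?_
  filter_upwards [coeFn_mulOp ha f, coeFn_mulOp ha g] with θ h1 h2
  rw [h1, h2]
  simp only [RCLike.inner_apply, map_mul, Complex.conj_ofReal]
  ring

namespace HalfFlux

variable {A a : ℝ → ℝ}

theorem inner_mulOp (hA : HalfFlux A) (ha : MemLp a ⊤ arc) (m : ℤ) {f : ℝ → ℂ} (hf : MemLp f 2 arc) :
    ⟪hA.basis m, mulOp ha hf.toLp⟫_ℂ = gaugeCoeff A m (fun θ => a θ * f θ) := by
  rw [inner_basis]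
  refine integral_congr_ae ?_
  filter_upwards [coeFn_mulOp ha hf.toLp, hf.coeFn_toLp] with θ h1 h2
  rw [h1, h2]

theorem gaugeCoeff_add (hA : HalfFlux A) (m : ℤ) {f g : ℝ → ℂ} (hf : MemLp f 2 arc)
    (hg : MemLp g 2 arc) :
    gaugeCoeff A m (fun θ => f θ + g θ) = gaugeCoeff A m f + gaugeCoeff A m g := by
  have h1 := ((hA.continuous_gaugeMode m).memLp_arc (p := 2)).star
  simp only [gaugeCoeff, mul_add]
  exact integral_add (integrable_mul_of_memLp h1 hf) (integrable_mul_of_memLp h1 hg)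

theorem gaugeCoeff_const_mul (A : ℝ → ℝ) (m : ℤ) (c : ℂ) (f : ℝ → ℂ) :
    gaugeCoeff A m (fun θ => c * f θ) = c * gaugeCoeff A m f := by
  simp only [gaugeCoeff, mul_left_comm _ c, integral_const_mul]

theorem gaugeCoeff_congr (A : ℝ → ℝ) (m : ℤ) {f g : ℝ → ℂ} (h : f =ᵐ[arc] g) :
    gaugeCoeff A m f = gaugeCoeff A m g := by
  refine integral_congr_ae ?_
  filter_upwards [h] with θ hθ
  rw [hθ]

/-- The spectral subspace of `L²` that corresponds to `eigenspace A a z`. -/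
abbrev lpEigenspace (hA : HalfFlux A) (ha : MemLp a ⊤ arc) (z : ℂ) : Submodule ℂ (Lp ℂ 2 arc) :=
  hA.basis.diagAddEigenspace halfIntSq (mulOp ha) z

theorem toLp_mem_lpEigenspace (hA : HalfFlux A) (ha : MemLp a ⊤ arc) {z : ℂ} {φ : ℝ → ℂ}
    (hφ : MemLp φ 2 arc) (h : MagneticSchrodinger A a φ (fun θ => z * φ θ)) :
    hφ.toLp ∈ hA.lpEigenspace ha z := by
  obtain ⟨ψ, χ, h1, h2, h3⟩ := h
  intro m
  have haφ : MemLp (fun θ => (a θ : ℂ) * φ θ) 2 arc := (ha.ofReal (K := ℂ)).mul_memLp_top hφ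
  have h4 := gaugeCoeff_congr A m h3
  rw [gaugeCoeff_const_mul, hA.gaugeCoeff_add m (hA.memLp_right h2) haφ] at h4
  rw [inner_basis_toLp, inner_mulOp, h4, hA.gaugeCoeff_of_magneticDeriv h2,
    hA.gaugeCoeff_of_magneticDeriv h1, halfIntSq]
  push_cast
  ring

theorem exists_lp_of_summable (hA : HalfFlux A) {c : ℤ → ℂ} (hc : Summable fun m => ‖c m‖ ^ 2) :
    ∃ f : Lp ℂ 2 arc, ∀ m, gaugeCoeff A m f = c m := by
  have hmem : Memℓp c 2 := by
    refine memℓp_gen ?_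
    simpa using hc
  refine ⟨hA.basis.repr.symm ⟨c, hmem⟩, fun m => ?_⟩
  rw [← hA.inner_basis, ← HilbertBasis.repr_apply_apply, LinearIsometryEquiv.apply_symm_apply]

/-- `D f = z f - V f` lies in `L²`, so `(m + 1/2)² |f_m|` is bounded. The first conclusion gives a
uniformly convergent mode series, the second puts `(-i d/dθ + A) f` in `L²`. -/
theorem summable_coeff (hA : HalfFlux A) (ha : MemLp a ⊤ arc) {z : ℂ} {f : Lp ℂ 2 arc}
    (hf : f ∈ hA.lpEigenspace ha z) :
    Summable (fun m => ‖gaugeCoeff A m f‖) ∧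
      Summable (fun m : ℤ => ‖((m : ℂ) + 1 / 2) * gaugeCoeff A m f‖ ^ 2) := by
  set g := z • f - mulOp ha f with hg
  have hcoef : ∀ m : ℤ, halfIntSq m * ‖gaugeCoeff A m f‖ ≤ ‖g‖ := by
    intro m
    have h1 : ⟪hA.basis m, g⟫_ℂ = halfIntSq m * ⟪hA.basis m, f⟫_ℂ := by
      rw [hg, inner_sub_right, inner_smul_right]
      linear_combination -hf m
    have h2 := norm_inner_le_norm (𝕜 := ℂ) (hA.basis m) g
    rw [h1, hA.basis.orthonormal.1 m, one_mul, norm_mul, Complex.norm_real,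
      Real.norm_of_nonneg (halfIntSq_nonneg m), inner_basis] at h2
    exact h2
  have hpos : ∀ m : ℤ, 0 < halfIntSq m := by
    intro m
    refine lt_of_le_of_ne (halfIntSq_nonneg m) fun h0 => ?_
    have h1 : (m : ℝ) + 1 / 2 = 0 := by
      rw [halfIntSq] at h0
      exact pow_eq_zero_iff two_ne_zero |>.1 h0.symm
    have h2 : ((2 * m + 1 : ℤ) : ℝ) = 0 := by push_cast; linarith
    have h3 : 2 * m + 1 = 0 := by exact_mod_cast h2
    omega
  have hs := summable_inv_halfIntSq_add (s := 0) le_rfl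
  simp only [add_zero] at hs
  have hsum : Summable (fun m => ‖gaugeCoeff A m f‖) := by
    refine Summable.of_nonneg_of_le (fun _ => norm_nonneg _) (fun m => ?_) (hs.mul_left ‖g‖)
    rw [← div_eq_mul_inv, le_div_iff₀ (hpos m), mul_comm]
    exact hcoef m
  refine ⟨hsum, Summable.of_nonneg_of_le (fun _ => by positivity) (fun m => ?_)
    (hsum.mul_left ‖g‖)⟩
  have h1 : ‖((m : ℂ) + 1 / 2)‖ ^ 2 = halfIntSq m := by
    rw [show (m : ℂ) + 1 / 2 = (((m : ℝ) + 1 / 2 : ℝ) : ℂ) by push_cast; ring, Complex.norm_real,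
      Real.norm_eq_abs, sq_abs, halfIntSq]
  rw [norm_mul, mul_pow, h1, sq, ← mul_assoc]
  exact mul_le_mul_of_nonneg_right (hcoef m) (norm_nonneg _)

theorem exists_continuous_of_summable (hA : HalfFlux A) {f : Lp ℂ 2 arc}
    (hf : Summable fun m => ‖gaugeCoeff A m f‖) :
    ∃ φ : ℝ → ℂ, Continuous φ ∧ Function.Periodic φ (2 * Real.pi) ∧ f =ᵐ[arc] φ ∧
      ∀ θ, HasSum (fun m => gaugeCoeff A m f * gaugeMode A m θ) (φ θ) := by
  let e : ℤ → BoundedContinuousFunction ℝ ℂ := fun m =>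
    BoundedContinuousFunction.ofNormedAddCommGroup (gaugeMode A m) (hA.continuous_gaugeMode m)
      (Real.sqrt (2 * Real.pi))⁻¹ fun θ => (norm_gaugeMode A m θ).le
  have he : ∀ m, ‖e m‖ ≤ (Real.sqrt (2 * Real.pi))⁻¹ := fun m =>
    BoundedContinuousFunction.norm_ofNormedAddCommGroup_le _ (by positivity) _
  have hs : Summable fun m => gaugeCoeff A m f • e m := by
    refine Summable.of_norm_bounded (hf.mul_right (Real.sqrt (2 * Real.pi))⁻¹) fun m => ?_
    rw [norm_smul]
    exact mul_le_mul_of_nonneg_left (he m) (norm_nonneg _)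
  obtain ⟨φ, hφ⟩ := hs
  have hpt : ∀ θ, HasSum (fun m => gaugeCoeff A m f * gaugeMode A m θ) (φ θ) := fun θ =>
    hφ.mapL (BoundedContinuousFunction.evalCLM ℂ θ)
  refine ⟨φ, φ.continuous, fun θ => ?_, ?_, hpt⟩
  · refine (hpt _).unique ?_
    simpa only [hA.periodic_gaugeMode _ θ] using hpt θ
  · have h1 := hφ.mapL (BoundedContinuousFunction.toLp (E := ℂ) 2 arc ℂ)
    have h2 := hA.basis.hasSum_repr f
    have h3 : BoundedContinuousFunction.toLp (E := ℂ) 2 arc ℂ φ = f := by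
      refine h1.unique ?_
      convert! h2 using 1
      ext1 m
      rw [map_smul, HilbertBasis.repr_apply_apply, inner_basis]
      congr 1
      rw [basis_apply, modeLp]
      refine Lp.ext ?_
      exact (BoundedContinuousFunction.coeFn_toLp (E := ℂ) 2 arc ℂ (e m)).trans
        (MemLp.coeFn_toLp _).symm
    rw [← h3]
    exact BoundedContinuousFunction.coeFn_toLp (E := ℂ) 2 arc ℂ φ

theorem exists_mem_eigenspace (hA : HalfFlux A) (ha : MemLp a ⊤ arc) {z : ℂ} {f : Lp ℂ 2 arc}
    (hf : f ∈ hA.lpEigenspace ha z) :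
    ∃ φ ∈ eigenspace A a z, f =ᵐ[arc] φ ∧
      ∀ θ, HasSum (fun m => gaugeCoeff A m f * gaugeMode A m θ) (φ θ) := by
  obtain ⟨hs1, hs2⟩ := hA.summable_coeff ha hf
  obtain ⟨φ, hc, hp, hae, hpt⟩ := hA.exists_continuous_of_summable hs1
  refine ⟨φ, ⟨hc, hp, ?_⟩, hae, hpt⟩
  obtain ⟨ψ, hψ⟩ := hA.exists_lp_of_summable hs2
  have hφ : MemLp φ 2 arc := hc.memLp_arc
  -- `ψ` has coefficients `(m + 1/2) f_m`; by the eigenvalue equation `z f - V f` has coefficients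
  -- `(m + 1/2)² f_m`, so it is the second magnetic derivative.
  refine ⟨ψ, (z • f - mulOp ha f : Lp ℂ 2 arc), hA.magneticDeriv_of_gaugeCoeff hφ (Lp.memLp _)
    fun m => ?_, hA.magneticDeriv_of_gaugeCoeff (Lp.memLp _) (Lp.memLp _) fun m => ?_, ?_⟩
  · rw [hψ, gaugeCoeff_congr A m hae]
  · rw [hψ, ← hA.inner_basis, inner_sub_right, inner_smul_right, ← hA.inner_basis]
    have := hf m
    rw [halfIntSq] at this
    push_cast at this
    linear_combination -this
  · filter_upwards [hae, Lp.coeFn_sub (z • f) (mulOp ha f), Lp.coeFn_smul z f, coeFn_mulOp ha f]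
      with θ h1 h2 h3 h4
    rw [h2, Pi.sub_apply, h3, h4, Pi.smul_apply, smul_eq_mul, h1]
    ring

theorem eq_of_ae_eq_of_periodic {φ ψ : ℝ → ℂ} (hφ : Continuous φ) (hψ : Continuous ψ)
    (pφ : Function.Periodic φ (2 * Real.pi)) (pψ : Function.Periodic ψ (2 * Real.pi))
    (h : φ =ᵐ[arc] ψ) : φ = ψ := by
  have h1 : Set.EqOn φ ψ (Set.Ioc 0 (2 * Real.pi)) :=
    Measure.eqOn_Ioc_of_ae_eq volume h hφ.continuousOn hψ.continuousOn
  ext θ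
  have hp : Function.Periodic (fun θ => (φ θ, ψ θ)) (2 * Real.pi) := fun θ => by
    simp only [pφ θ, pψ θ]
  obtain ⟨y, hy, h2⟩ := hp.exists_mem_Ioc Real.two_pi_pos θ 0
  rw [zero_add] at hy
  rw [Prod.mk.injEq] at h2
  rw [h2.1, h2.2, h1 hy]

/-- The eigenspaces of the magnetic Schrödinger operator, in terms of Fourier coefficients. -/
theorem nonempty_eigenspace_equiv (hA : HalfFlux A) (ha : MemLp a ⊤ arc) (z : ℂ) :
    Nonempty (eigenspace A a z ≃ₗ[ℂ] hA.lpEigenspace ha z) := by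
  let F : eigenspace A a z →ₗ[ℂ] hA.lpEigenspace ha z :=
    { toFun := fun φ => ⟨(φ.2.1.memLp_arc (p := 2)).toLp,
        hA.toLp_mem_lpEigenspace ha _ φ.2.2.2⟩
      map_add' := fun φ ψ => rfl
      map_smul' := fun c φ => rfl }
  refine ⟨LinearEquiv.ofBijective F ⟨fun φ ψ h => ?_, fun f => ?_⟩⟩
  · have h1 := congrArg Subtype.val h
    have h2 := (MemLp.toLp_eq_toLp_iff φ.2.1.memLp_arc ψ.2.1.memLp_arc).1 h1
    exact Subtype.ext (eq_of_ae_eq_of_periodic φ.2.1 ψ.2.1 φ.2.2.1 ψ.2.2.1 h2)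
  · obtain ⟨φ, hφ, hae, -⟩ := hA.exists_mem_eigenspace ha f.2
    refine ⟨⟨φ, hφ⟩, Subtype.ext (Lp.ext ?_)⟩
    exact (MemLp.coeFn_toLp (Continuous.memLp_arc hφ.1)).trans hae.symm

end HalfFlux

end CircleMagnetic

/-! ### Matrix elements of `a`, conjugation symmetry and eigenfunction asymptotics. -/

namespace CircleMagnetic

/-- The exponential `e^{ikθ}` is itself a test function, and its derivative contributes the factor
`ik`. -/
theorem HasWeakDeriv.norm_integral_mul_exp_le {f g : ℝ → ℂ} (h : HasWeakDeriv f g) {k : ℤ}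
    (hk : k ≠ 0) :
    ‖∫ θ, f θ * Complex.exp ((k : ℂ) * Complex.I * (θ : ℝ)) ∂arc‖ ≤
      (∫ θ, ‖g θ‖ ∂arc) / |(k : ℝ)| := by
  set η : ℝ → ℂ := fun θ => Complex.exp ((k : ℂ) * Complex.I * (θ : ℝ)) with hη
  have hsm : ContDiff ℝ (⊤ : ℕ∞) η := (contDiff_const.mul Complex.ofRealCLM.contDiff).cexp
  have hper : Function.Periodic η (2 * Real.pi) := fun θ => by
    simp only [hη]
    rw [Complex.exp_eq_exp_iff_exists_int.2 ⟨k, ?_⟩]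
    push_cast
    ring
  have hder : ∀ θ, deriv η θ = (k : ℂ) * Complex.I * η θ := fun θ => by
    have := ((Complex.ofRealCLM.hasDerivAt (x := θ)).const_mul ((k : ℂ) * Complex.I)).cexp
    refine this.deriv.trans ?_
    simp [hη, mul_comm]
  have h1 := h η hsm hper
  simp only [hder] at h1
  have h2 : ∫ θ, f θ * ((k : ℂ) * Complex.I * η θ) ∂arc =
      (k : ℂ) * Complex.I * ∫ θ, f θ * η θ ∂arc := by
    rw [← integral_const_mul]
    congr 1
    ext θ
    ring
  have hηn : ∀ θ, ‖η θ‖ = 1 := fun θ => by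
    simp only [hη]
    rw [show (k : ℂ) * Complex.I * (θ : ℝ) = ((k * θ : ℝ) : ℂ) * Complex.I by push_cast; ring,
      Complex.norm_exp_ofReal_mul_I]
  have hkpos : 0 < |(k : ℝ)| := abs_pos.2 (by exact_mod_cast hk)
  rw [le_div_iff₀ hkpos]
  calc ‖∫ θ, f θ * η θ ∂arc‖ * |(k : ℝ)| = ‖∫ θ, g θ * η θ ∂arc‖ := by
        rw [← norm_neg (∫ θ, g θ * η θ ∂arc), ← h1, h2, norm_mul, norm_mul, Complex.norm_I, mul_one,
          Complex.norm_intCast, mul_comm]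
    _ ≤ ∫ θ, ‖g θ * η θ‖ ∂arc := norm_integral_le_integral_norm _
    _ = ∫ θ, ‖g θ‖ ∂arc := by simp only [norm_mul, hηn, mul_one]

namespace HalfFlux

variable {A a : ℝ → ℝ}

/-- The gauge factors `e^{∓i∫A}` cancel, leaving a Fourier coefficient of `a` that depends only on
`l - m`. -/
theorem inner_basis_mulOp_basis (hA : HalfFlux A) (ha : MemLp a ⊤ arc) (m l : ℤ) :
    ⟪hA.basis m, mulOp ha (hA.basis l)⟫_ℂ = ((2 * Real.pi : ℝ) : ℂ)⁻¹ *
      ∫ θ, (a θ : ℂ) * Complex.exp (((l - m : ℤ) : ℂ) * Complex.I * (θ : ℝ)) ∂arc := by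
  rw [basis_apply hA l, modeLp, inner_mulOp, gaugeCoeff, ← integral_const_mul]
  congr 1
  ext θ
  rw [mul_left_comm, conj_gaugeMode_mul_gaugeMode]
  ring

theorem inner_basis_mulOp_basis_self (hA : HalfFlux A) (ha : MemLp a ⊤ arc) (m : ℤ) :
    ⟪hA.basis m, mulOp ha (hA.basis m)⟫_ℂ = circleMean a := by
  rw [inner_basis_mulOp_basis, circleMean, ← integral_arc]
  simp only [sub_self, Int.cast_zero, zero_mul, Complex.exp_zero, mul_one]
  rw [one_div, Complex.ofReal_mul (2 * Real.pi)⁻¹, Complex.ofReal_inv]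
  congr 1
  exact integral_ofReal

theorem norm_inner_basis_mulOp_basis_le (hA : HalfFlux A) (ha : MemLp a ⊤ arc) {g : ℝ → ℂ}
    (hg : HasWeakDeriv (fun θ => (a θ : ℂ)) g) {n : ℤ} (hn : 1 ≤ n) :
    ‖⟪hA.basis n, mulOp ha (hA.basis (-1 - n))⟫_ℂ‖ ≤ (∫ θ, ‖g θ‖ ∂arc) / n := by
  have hn' : (1 : ℝ) ≤ n := by exact_mod_cast hn
  have hk : -1 - n - n ≠ 0 := by omega
  have hG : 0 ≤ ∫ θ, ‖g θ‖ ∂arc := integral_nonneg fun _ => norm_nonneg _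
  have hpi := Real.pi_gt_three
  rw [inner_basis_mulOp_basis, norm_mul, norm_inv, Complex.norm_real,
    Real.norm_of_nonneg Real.two_pi_pos.le]
  calc _ ≤ 1 * ((∫ θ, ‖g θ‖ ∂arc) / n) := by
        refine mul_le_mul (inv_le_one_of_one_le₀ (by linarith))
          ((hg.norm_integral_mul_exp_le hk).trans ?_) (norm_nonneg _) zero_le_one
        refine div_le_div_of_nonneg_left hG (by linarith) ?_
        rw [le_abs]
        right
        push_cast
        linarith
    _ = _ := one_mul _

/-- The antilinear symmetry `f ↦ e^{-2i∫A} f̄` exchanges the modes `m` and `-1 - m`. -/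
theorem gaugeCoeff_conj (A : ℝ → ℝ) (m : ℤ) (f : ℝ → ℂ) :
    gaugeCoeff A m (fun θ => 2 * Real.pi * (gaugeMode A 0 θ * gaugeMode A (-1) θ) * conj (f θ)) =
      conj (gaugeCoeff A (-1 - m) f) := by
  rw [gaugeCoeff, gaugeCoeff, ← integral_conj]
  congr 1
  ext θ
  rw [map_mul, Complex.conj_conj, ← mul_assoc]
  congr 1
  simp only [gaugeMode, map_mul, Complex.conj_ofReal, ← Complex.exp_conj, Complex.conj_I]
  have h1 : (((Real.sqrt (2 * Real.pi))⁻¹ : ℝ) : ℂ) * (((Real.sqrt (2 * Real.pi))⁻¹ : ℝ) : ℂ) *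
      (2 * Real.pi) = 1 := by
    rw [← Complex.ofReal_mul, ← mul_inv, Real.mul_self_sqrt Real.two_pi_pos.le]
    have := Real.pi_ne_zero
    push_cast
    field_simp
  have h2 : Complex.exp (-Complex.I * (gaugePhase A m θ : ℝ)) *
      (Complex.exp (Complex.I * (gaugePhase A 0 θ : ℝ)) *
        Complex.exp (Complex.I * (gaugePhase A (-1) θ : ℝ))) =
      Complex.exp (Complex.I * (gaugePhase A (-1 - m) θ : ℝ)) := by
    rw [← Complex.exp_add, ← Complex.exp_add]
    congr 1
    simp only [gaugePhase]
    push_cast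
    ring
  rw [← h2]
  linear_combination ((((Real.sqrt (2 * Real.pi))⁻¹ : ℝ) : ℂ)) *
    (Complex.exp (-Complex.I * (gaugePhase A m θ : ℝ)) *
      (Complex.exp (Complex.I * (gaugePhase A 0 θ : ℝ)) *
        Complex.exp (Complex.I * (gaugePhase A (-1) θ : ℝ)))) * h1

theorem exists_conj_mem_lpEigenspace (hA : HalfFlux A) (ha : MemLp a ⊤ arc) {lam : ℝ}
    {f : Lp ℂ 2 arc} (hf : f ∈ hA.lpEigenspace ha lam) :
    ∃ g ∈ hA.lpEigenspace ha lam,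
      ∀ m, ⟪hA.basis m, g⟫_ℂ = conj ⟪hA.basis (-1 - m), f⟫_ℂ := by
  -- This is `e^{-2i∫A}`: the phases `± θ/2` of the two modes cancel. The form as a product of modes
  -- makes continuity immediate.
  set γ : ℝ → ℂ := fun θ => 2 * Real.pi * (gaugeMode A 0 θ * gaugeMode A (-1) θ) with hγ
  have hγc : Continuous γ := by
    have h0 := hA.continuous_gaugeMode 0
    have h1 := hA.continuous_gaugeMode (-1)
    fun_prop
  have hg : MemLp (fun θ => γ θ * conj (f θ)) 2 arc :=
    (hγc.memLp_arc (p := ⊤)).mul_memLp_top (Lp.memLp f).star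
  have hcoef : ∀ m, ⟪hA.basis m, hg.toLp⟫_ℂ = conj ⟪hA.basis (-1 - m), f⟫_ℂ := fun m => by
    rw [inner_basis_toLp, inner_basis, gaugeCoeff_conj]
  refine ⟨hg.toLp, fun m => ?_, hcoef⟩
  have h1 : ⟪hA.basis m, mulOp ha hg.toLp⟫_ℂ = conj ⟪hA.basis (-1 - m), mulOp ha f⟫_ℂ := by
    rw [inner_mulOp, inner_basis, ← gaugeCoeff_conj]
    refine gaugeCoeff_congr A m ?_
    filter_upwards [coeFn_mulOp ha f] with θ hθ
    rw [hθ, map_mul, Complex.conj_ofReal]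
    ring
  have h2 := congrArg conj (hf (-1 - m))
  rw [map_add, map_mul, map_mul, Complex.conj_ofReal, Complex.conj_ofReal,
    halfIntSq_neg_one_sub] at h2
  rw [hcoef, h1]
  exact h2

theorem exists_normalized_conj_symm_eigenvector (hA : HalfFlux A) (ha : MemLp a ⊤ arc) {lam : ℝ}
    {f : Lp ℂ 2 arc} (hf : f ∈ hA.lpEigenspace ha lam) (hf0 : f ≠ 0) :
    ∃ g ∈ hA.lpEigenspace ha lam, ‖g‖ = 1 ∧
      ∀ m, ⟪hA.basis (-1 - m), g⟫_ℂ = conj ⟪hA.basis m, g⟫_ℂ :=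
  HilbertBasis.exists_conj_symm_eigenvector
    (fun _ hx => hA.exists_conj_mem_lpEigenspace ha hx) hf hf0

/-- Apart from the common factor `e^{-i∫A}` the two terms are complex conjugates, so they sum to
twice a real part; `2/√(2π) = √2/√π` accounts for the constants. -/
theorem mul_gaugeMode_add_conj (A : ℝ → ℝ) (n : ℤ) (c : ℂ) (θ : ℝ) :
    c * gaugeMode A n θ + conj c * gaugeMode A (-1 - n) θ =
      ((1 / Real.sqrt Real.pi : ℝ) : ℂ) *
        Complex.exp (-Complex.I * ((∫ t in (0 : ℝ)..θ, A t : ℝ) : ℂ)) *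
        ((Real.sqrt 2 * ‖c‖ * Real.cos (((n : ℝ) + 1 / 2) * θ + c.arg) : ℝ) : ℂ) := by
  set P := ∫ t in (0 : ℝ)..θ, A t with hP
  set ω := ((n : ℝ) + 1 / 2) * θ with hω
  have hs : (((Real.sqrt (2 * Real.pi))⁻¹ : ℝ) : ℂ) * 2 =
      ((1 / Real.sqrt Real.pi : ℝ) : ℂ) * ((Real.sqrt 2 : ℝ) : ℂ) := by
    have h2 : Real.sqrt 2 * Real.sqrt 2 = 2 := Real.mul_self_sqrt (by norm_num)
    have h3 : Real.sqrt 2 ≠ 0 := by positivity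
    have h4 : Real.sqrt Real.pi ≠ 0 := by have := Real.pi_pos; positivity
    have h5 : (Real.sqrt (2 * Real.pi))⁻¹ * 2 = 1 / Real.sqrt Real.pi * Real.sqrt 2 := by
      rw [Real.sqrt_mul (by norm_num)]
      field_simp
      linarith
    exact_mod_cast congrArg (fun x : ℝ => (x : ℂ)) h5
  have e1 : Complex.exp (Complex.I * (gaugePhase A n θ : ℝ)) =
      Complex.exp (-Complex.I * (P : ℂ)) * Complex.exp (ω * Complex.I) := by
    rw [← Complex.exp_add, gaugePhase, ← hP, ← hω]
    congr 1
    push_cast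
    ring
  have e2 : Complex.exp (Complex.I * (gaugePhase A (-1 - n) θ : ℝ)) =
      Complex.exp (-Complex.I * (P : ℂ)) * Complex.exp (-ω * Complex.I) := by
    rw [← Complex.exp_add, gaugePhase, ← hP, hω]
    congr 1
    push_cast
    ring
  have hc := (Complex.norm_mul_exp_arg_mul_I c).symm
  have hc' : conj c = ‖c‖ * Complex.exp (-(c.arg : ℂ) * Complex.I) := by
    conv_lhs => rw [hc]
    rw [map_mul, Complex.conj_ofReal, ← Complex.exp_conj, map_mul, Complex.conj_I,
      Complex.conj_ofReal]
    ring_nf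
  have hcos : (2 : ℂ) * Complex.cos ((ω : ℂ) + c.arg) =
      Complex.exp (c.arg * Complex.I) * Complex.exp (ω * Complex.I) +
      Complex.exp (-(c.arg : ℂ) * Complex.I) * Complex.exp (-ω * Complex.I) := by
    rw [Complex.two_cos, ← Complex.exp_add, ← Complex.exp_add]
    ring_nf
  rw [gaugeMode, gaugeMode, e1, e2, hc']
  push_cast at hs ⊢
  linear_combination ((((Real.sqrt (2 * Real.pi)) : ℝ) : ℂ)⁻¹) *
    Complex.exp (-Complex.I * (P : ℂ)) * Complex.exp (ω * Complex.I) * hc + ((((Real.sqrt (2 * Real.pi)) : ℝ) : ℂ)⁻¹) *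
    Complex.exp (-Complex.I * (P : ℂ)) * ‖c‖ * (-hcos) +
    Complex.exp (-Complex.I * (P : ℂ)) * ‖c‖ * Complex.cos ((ω : ℂ) + c.arg) * hs

/-- Take `ϑ = -arg c / x`, with `2π` added to the numerator when `arg c` is positive; dividing by `x
≥ 1` keeps it in `[0, 2π]`. -/
theorem exists_phase {x : ℝ} (hx : 1 ≤ x) (c : ℂ) :
    ∃ ϑ ∈ Set.Icc 0 (2 * Real.pi), ∀ θ, Real.cos (x * θ + c.arg) = Real.cos (x * (θ - ϑ)) := by
  have hx0 : x ≠ 0 := by linarith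
  have hpi := Real.pi_pos
  have key : ∀ α, 0 ≤ α → α ≤ 2 * Real.pi → α / x ∈ Set.Icc 0 (2 * Real.pi) := fun α h0 h1 =>
    ⟨by positivity, (div_le_self h0 hx).trans h1⟩
  rcases le_total c.arg 0 with h | h
  · refine ⟨-c.arg / x, key _ (by linarith) (by linarith [c.neg_pi_lt_arg]), fun θ => ?_⟩
    rw [mul_sub, mul_div_cancel₀ _ hx0, sub_neg_eq_add]
  · refine ⟨(2 * Real.pi - c.arg) / x, key _ (by linarith [c.arg_le_pi]) (by linarith), fun θ => ?_⟩
    rw [mul_sub, mul_div_cancel₀ _ hx0, ← Real.cos_sub_two_pi]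
    ring_nf

theorem exists_eigenfunction_asymptotics (hA : HalfFlux A) (ha : MemLp a ⊤ arc) {g : ℝ → ℂ}
    (hg : HasWeakDeriv (fun θ => (a θ : ℂ)) g) {n : ℤ} (hn : 1 ≤ n)
    (hlarge : 2 * (‖mulOp ha‖ ^ 2 + 2 * sumInvSq) ≤ n) {lam : ℝ} (h1 : (n : ℝ) ^ 2 < lam)
    (h2 : lam ≤ ((n : ℝ) + 1) ^ 2) {f : Lp ℂ 2 arc} (hf : f ∈ hA.lpEigenspace ha lam)
    (hf0 : f ≠ 0) :
    |lam - (circleMean a + halfIntSq n)| ≤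
      ((∫ θ, ‖g θ‖ ∂arc) + 2 * ‖mulOp ha‖ * (‖mulOp ha‖ ^ 2 + 2 * sumInvSq)) / n ∧
    ∃ ϑ ∈ Set.Icc 0 (2 * Real.pi), ∃ φ ∈ eigenspace A a lam, ∃ R : ℝ → ℂ,
      (∫ θ in (0 : ℝ)..(2 * Real.pi), ‖φ θ‖ ^ 2) = 1 ∧
      (∀ θ, φ θ = ((1 / Real.sqrt Real.pi : ℝ) : ℂ)
                * Complex.exp (-Complex.I * ((∫ t in (0 : ℝ)..θ, A t : ℝ) : ℂ))
                * ((Real.cos (((n : ℝ) + 1 / 2) * (θ - ϑ)) : ℂ) + R θ)) ∧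
      ∀ θ, ‖R θ‖ ≤ 2 * (‖mulOp ha‖ ^ 2 + 2 * sumInvSq) / n := by
  obtain ⟨u, hu, hu1, hconj⟩ := hA.exists_normalized_conj_symm_eigenvector ha hf hf0
  obtain ⟨hc, hlam⟩ := HilbertBasis.eigenvector_estimates hu hu1 (hconj n) hn h1 h2 hlarge
    (hA.inner_basis_mulOp_basis_self ha n) (hA.norm_inner_basis_mulOp_basis_le ha hg hn)
  obtain ⟨hts, htle⟩ := HilbertBasis.tailCoeff_bound hu hu1 hn h1 h2
  refine ⟨hlam, ?_⟩
  set τ := (‖mulOp ha‖ ^ 2 + 2 * sumInvSq) / n with hτ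
  set c := ⟪hA.basis n, u⟫_ℂ with hcdef
  have hn1 : (1 : ℝ) ≤ n := by exact_mod_cast hn
  obtain ⟨ϑ, hϑ, hcos⟩ := exists_phase (x := (n : ℝ) + 1 / 2) (by linarith) c
  obtain ⟨φ, hφ, hae, hpt⟩ := hA.exists_mem_eigenspace ha hu
  let E : ℝ → ℂ := fun θ => ((1 / Real.sqrt Real.pi : ℝ) : ℂ)
    * Complex.exp (-Complex.I * ((∫ t in (0 : ℝ)..θ, A t : ℝ) : ℂ))
  have hpi := Real.pi_pos
  have hEn : ∀ θ, ‖E θ‖ = (Real.sqrt Real.pi)⁻¹ := fun θ => by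
    simp only [E]
    rw [norm_mul, Complex.norm_real, Real.norm_of_nonneg (by positivity), one_div,
      show ∀ x : ℝ, -Complex.I * (x : ℂ) = Complex.I * ((-x : ℝ) : ℂ) from fun x => by
        push_cast; ring, Complex.norm_exp_I_mul_ofReal, mul_one]
  have hE0 : ∀ θ, E θ ≠ 0 := fun θ => by
    rw [← norm_pos_iff, hEn]
    positivity
  let p : ℝ → ℂ := fun θ => c * gaugeMode A n θ + conj c * gaugeMode A (-1 - n) θ
  have hp : ∀ θ, p θ = E θ * ((Real.sqrt 2 * ‖c‖ * Real.cos (((n : ℝ) + 1 / 2) * (θ - ϑ)) : ℝ) : ℂ) :=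
    fun θ => by
      simp only [p, E]
      rw [mul_gaugeMode_add_conj, hcos]
  have htail : ∀ θ, ‖φ θ - p θ‖ ≤ (Real.sqrt (2 * Real.pi))⁻¹ * τ := by
    intro θ
    have hs := hasSum_ite_or (fun m => gaugeCoeff A m u * gaugeMode A m θ)
      (show n ≠ -1 - n by omega)
    have hs2 : HasSum (fun m => hA.basis.tailCoeff u n m * gaugeMode A m θ) (φ θ - p θ) := by
      simp only [p]
      rw [hcdef, ← hconj, inner_basis, inner_basis]
      convert! (hpt θ).sub hs using 1
      ext m
      simp only [HilbertBasis.tailCoeff, inner_basis]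
      split_ifs <;> simp
    have hnorm : ∀ m, ‖hA.basis.tailCoeff u n m * gaugeMode A m θ‖ =
        (Real.sqrt (2 * Real.pi))⁻¹ * ‖hA.basis.tailCoeff u n m‖ := fun m => by
      rw [norm_mul, norm_gaugeMode, mul_comm]
    rw [← hs2.tsum_eq]
    refine (norm_tsum_le_tsum_norm (by simpa only [hnorm] using hts.mul_left _)).trans ?_
    simp only [hnorm]
    rw [tsum_mul_left]
    gcongr
  -- The remainder has two sources, each at most `τ`: the amplitude error `√2|c| - 1` of the cosine,
  -- and the tail of the mode series divided by the prefactor `E`.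
  refine ⟨ϑ, hϑ, φ, hφ, fun θ => ((Real.sqrt 2 * ‖c‖ - 1) *
    Real.cos (((n : ℝ) + 1 / 2) * (θ - ϑ)) : ℝ) + (E θ)⁻¹ * (φ θ - p θ), ?_, fun θ => ?_, fun θ => ?_⟩
  · have h3 := norm_sq_eq_integral u
    rw [hu1, one_pow] at h3
    rw [← integral_arc, h3]
    refine integral_congr_ae ?_
    filter_upwards [hae] with θ hθ
    rw [hθ]
  · change φ θ = E θ * _
    have h3 : E θ * ((E θ)⁻¹ * (φ θ - p θ)) = φ θ - p θ := mul_inv_cancel_left₀ (hE0 θ) _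
    have h4 := hp θ
    push_cast at h4 ⊢
    linear_combination -h3 + h4
  · have hτ0 : 0 ≤ τ := (abs_nonneg _).trans hc
    have hsq : (Real.sqrt (2 * Real.pi))⁻¹ * τ ≤ (Real.sqrt Real.pi)⁻¹ * τ := by
      gcongr
      linarith
    calc _ ≤ ‖(((Real.sqrt 2 * ‖c‖ - 1) * Real.cos (((n : ℝ) + 1 / 2) * (θ - ϑ)) : ℝ) : ℂ)‖ +
          ‖(E θ)⁻¹ * (φ θ - p θ)‖ := norm_add_le _ _
      _ ≤ τ * 1 + Real.sqrt Real.pi * ((Real.sqrt Real.pi)⁻¹ * τ) := by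
        refine add_le_add ?_ ?_
        · rw [Complex.norm_real, Real.norm_eq_abs, abs_mul]
          exact mul_le_mul hc (Real.abs_cos_le_one _) (abs_nonneg _) hτ0
        · rw [norm_mul, norm_inv, hEn, inv_inv]
          exact mul_le_mul_of_nonneg_left ((htail θ).trans hsq) (Real.sqrt_nonneg _)
      _ = 2 * τ := by
        rw [mul_inv_cancel_left₀ (by positivity)]
        ring
      _ = _ := by rw [hτ]; ring

end HalfFlux

end CircleMagnetic

/-! ### Eigenvalue sequences and the main theorem. -/

theorem finite_fiber_of_tendsto {μ : ℕ+ → ℝ} (h : Tendsto μ atTop atTop) (z : ℂ) :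
    {k | (μ k : ℂ) = z}.Finite := by
  obtain ⟨K, hK⟩ := (h.eventually_gt_atTop z.re).exists_forall_of_atTop
  refine (Set.finite_Iio K).subset fun k hk => ?_
  by_contra! hlt
  have h1 := hK k (by simpa using hlt)
  have h2 : (μ k : ℂ) = z := hk
  rw [← h2, Complex.ofReal_re] at h1
  exact lt_irrefl _ h1

namespace CircleMagnetic

namespace HalfFlux

variable {A a : ℝ → ℝ}

theorem exists_isEigenvalueSequence (hA : HalfFlux A) (ha : MemLp a ⊤ arc) :
    ∃ (u : HilbertBasis ℕ+ ℂ (Lp ℂ 2 arc)) (μ : ℕ+ → ℝ), IsEigenvalueSequence A a μ ∧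
      ∀ k, u k ∈ hA.lpEigenspace ha (μ k) := by
  obtain ⟨u, μ, hmono, htend, hu⟩ := hA.basis.exists_sorted_eigenbasis (isSymmetric_mulOp ha)
  have key := fun z => HilbertBasis.finrank_diagAddEigenspace (isSymmetric_mulOp ha) u hu
    (finite_fiber_of_tendsto htend z)
  refine ⟨u, μ, ⟨hmono, htend, fun z => ?_, fun z => ?_⟩, hu⟩
  · obtain ⟨e⟩ := hA.nonempty_eigenspace_equiv ha z
    have := (key z).1
    exact e.symm.finiteDimensional
  · obtain ⟨e⟩ := hA.nonempty_eigenspace_equiv ha z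
    rw [(key z).2, e.finrank_eq]

/-- Any two eigenvalue sequences take each real value equally often, so matching their finite fibres
reindexes the constructed eigenbasis to the given sequence. -/
theorem exists_eigenbasis_of_isEigenvalueSequence (hA : HalfFlux A) (ha : MemLp a ⊤ arc)
    {μ : ℕ+ → ℝ} (hμ : IsEigenvalueSequence A a μ) :
    ∃ u : HilbertBasis ℕ+ ℂ (Lp ℂ 2 arc), ∀ k, u k ∈ hA.lpEigenspace ha (μ k) := by
  obtain ⟨u, ν, hν, hu⟩ := hA.exists_isEigenvalueSequence ha
  have hequiv : ∀ c : ℝ, Nonempty ({k // μ k = c} ≃ {k // ν k = c}) := by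
    intro c
    have h1 := finite_fiber_of_tendsto hμ.tendsto c
    have h2 := finite_fiber_of_tendsto hν.tendsto c
    have h3 := (hμ.count c).trans (hν.count c).symm
    simp only [Complex.ofReal_inj] at h1 h2 h3
    have h4 : Finite {k // μ k = c} := h1
    have h5 : Finite {k // ν k = c} := h2
    exact Finite.card_eq.1 h3
  let σ := Equiv.ofFiberEquiv fun c => (hequiv c).some
  have hσ : ∀ k, ν (σ k) = μ k := Equiv.ofFiberEquiv_map _
  obtain ⟨v, hv⟩ := HilbertBasis.exists_reindex u σ
  exact ⟨v, fun k => by rw [hv, ← hσ]; exact hu _⟩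

end HalfFlux

end CircleMagnetic

end

theorem lemmaB5 (a A : ℝ → ℝ) (ha : CircleMagnetic.MemW1Infty a)
    (hA : CircleMagnetic.MemW1Infty A)
    (hhalf : ∃ m : ℤ, CircleMagnetic.circleMean A = (m : ℝ) + 1 / 2) :
    (∃ μ : ℕ+ → ℝ, CircleMagnetic.IsEigenvalueSequence A a μ) ∧
    ∀ μ : ℕ+ → ℝ, CircleMagnetic.IsEigenvalueSequence A a μ →
      ∃ (kstar ℓ : ℕ) (lam : ℤ → ℝ), 1 ≤ ℓ ∧
        -- the families `(μ_k)_{k > kstar}` and `(lam_j)_{|j| ≥ ℓ}` agree, with multiplicities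
        (∃ σ : {j : ℤ // (ℓ : ℤ) ≤ |j|} ≃ {k : ℕ+ // kstar < (k : ℕ)},
          ∀ j : {j : ℤ // (ℓ : ℤ) ≤ |j|}, lam (j : ℤ) = μ (σ j : ℕ+)) ∧
        (∃ C : ℝ, ∀ j : ℤ, (ℓ : ℤ) ≤ |j| →
          |lam j - (CircleMagnetic.circleMean a + ((j : ℝ) + 1 / 2) ^ 2)| ≤ C / |(j : ℝ)|) ∧
        ∃ (ϑ : ℤ → ℝ) (φ R : ℤ → ℝ → ℂ),
          (∀ j : ℤ, (ℓ : ℤ) ≤ |j| →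
            ϑ j ∈ Set.Icc 0 (2 * Real.pi) ∧
            φ j ∈ CircleMagnetic.eigenspace A a (lam j : ℂ) ∧
            (∫ θ in (0 : ℝ)..(2 * Real.pi), ‖φ j θ‖ ^ 2) = 1 ∧
            ∀ θ ∈ Set.Icc (0 : ℝ) (2 * Real.pi),
              φ j θ = ((1 / Real.sqrt Real.pi : ℝ) : ℂ)
                * Complex.exp (-Complex.I * ((∫ t in (0 : ℝ)..θ, A t : ℝ) : ℂ))
                * ((Real.cos (((j : ℝ) + 1 / 2) * (θ - ϑ j)) : ℂ) + R j θ)) ∧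
          ∃ C : ℝ, ∀ j : ℤ, (ℓ : ℤ) ≤ |j| → ∀ θ ∈ Set.Icc (0 : ℝ) (2 * Real.pi),
            ‖R j θ‖ ≤ C / |(j : ℝ)| := by
  open CircleMagnetic in
  have hF : HalfFlux A := ⟨hA.periodic, hA.memLp, hhalf⟩
  obtain ⟨g, -, hg⟩ := ha.weakDeriv
  refine ⟨?_, fun μ hμ => ?_⟩
  · obtain ⟨-, μ, hμ, -⟩ := hF.exists_isEigenvalueSequence ha.memLp
    exact ⟨μ, hμ⟩
  obtain ⟨u, hu⟩ := hF.exists_eigenbasis_of_isEigenvalueSequence ha.memLp hμ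
  set V := mulOp ha.memLp with hV
  set K := ‖V‖ ^ 2 + 2 * sumInvSq with hK
  have hK0 : 0 ≤ K := by
    have : 0 ≤ sumInvSq := tsum_nonneg fun m => by positivity
    positivity
  set G := (∫ θ, ‖(g θ : ℂ)‖ ∂arc) + 2 * ‖V‖ * K with hG
  have hG0 : 0 ≤ G := by
    have : 0 ≤ ∫ θ, ‖(g θ : ℂ)‖ ∂arc := integral_nonneg fun _ => norm_nonneg _
    positivity
  -- The first bound makes every window from `N` on contain exactly two eigenvalues; the second
  -- makes the tail at most `1/2`.
  obtain ⟨N, hN⟩ := exists_nat_ge (max (‖V‖ + 2) (2 * K))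
  have hNV : ‖V‖ + 2 ≤ N := (le_max_left _ _).trans hN
  have hNK : 2 * K ≤ N := (le_max_right _ _).trans hN
  obtain ⟨kstar, σ, hσ⟩ := exists_equiv_of_ncard_eq_two hμ.mono hμ.tendsto N fun n hn =>
    HilbertBasis.ncard_cluster (isSymmetric_mulOp ha.memLp) u hu (by
      have : (N : ℝ) ≤ n := by exact_mod_cast hn
      linarith)
  have hmain : ∀ j : {j : ℤ // ((N + 1 : ℕ) : ℤ) ≤ |j|},
      |μ (σ j : ℕ+) - (circleMean a + (((j : ℤ) : ℝ) + 1 / 2) ^ 2)| ≤ (2 * G) / |((j : ℤ) : ℝ)| ∧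
      ∃ ϑ ∈ Set.Icc 0 (2 * Real.pi), ∃ φ ∈ CircleMagnetic.eigenspace A a (μ (σ j : ℕ+) : ℂ),
        ∃ R : ℝ → ℂ, (∫ θ in (0 : ℝ)..(2 * Real.pi), ‖φ θ‖ ^ 2) = 1 ∧
        (∀ θ, φ θ = ((1 / Real.sqrt Real.pi : ℝ) : ℂ)
                * Complex.exp (-Complex.I * ((∫ t in (0 : ℝ)..θ, A t : ℝ) : ℂ))
                * ((Real.cos ((((j : ℤ) : ℝ) + 1 / 2) * (θ - ϑ)) : ℂ) + R θ)) ∧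
        ∀ θ, ‖R θ‖ ≤ (4 * K) / |((j : ℤ) : ℝ)| := by
    intro j
    obtain ⟨h1, h2⟩ := hσ j
    set n := foldIndex j with hn
    have hcases := foldIndex_cases j
    rw [← hn] at hcases
    have hj := j.2
    rw [le_abs] at hj
    have hn1 : 1 ≤ n := by
      have : 1 ≤ N := by
        have : (1 : ℝ) ≤ N := by linarith [norm_nonneg V]
        exact_mod_cast this
      omega
    have hnN : N ≤ n := by omega
    have hn1' : (1 : ℝ) ≤ n := by exact_mod_cast hn1
    have hnN' : (N : ℝ) ≤ n := by exact_mod_cast hnN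
    obtain ⟨hlam, ϑ, hϑ, φ, hφ, R, hint, hform, hR⟩ :=
      hF.exists_eigenfunction_asymptotics ha.memLp hg (n := (n : ℤ)) (by omega)
        (by rw [Int.cast_natCast]; linarith) (by rwa [Int.cast_natCast])
        (by rwa [Int.cast_natCast]) (hu (σ j)) (u.orthonormal.ne_zero _)
    rw [Int.cast_natCast] at hlam hR
    have hjpos : 0 < |((j : ℤ) : ℝ)| := by
      rw [abs_pos]
      have : (j : ℤ) ≠ 0 := by omega
      exact_mod_cast this
    -- Since `|j| ≤ n + 1 ≤ 2n`, bounds in `1/n` become bounds in `1/|j|` with doubled constants.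
    have hjn : |((j : ℤ) : ℝ)| ≤ 2 * n := by
      have : |(j : ℤ)| ≤ 2 * n := by
        rw [abs_le]
        omega
      exact_mod_cast this
    have hdiv : ∀ x : ℝ, 0 ≤ x → x / n ≤ (2 * x) / |((j : ℤ) : ℝ)| := fun x hx => by
      rw [div_le_div_iff₀ (by linarith) hjpos]
      nlinarith
    -- For `j = -1 - n` the frequency `j + 1/2` is `-(n + 1/2)`, and the cosine is even. Both labels
    -- of a window can thus use the same expansion.
    have hcosj : ∀ θ : ℝ, Real.cos (((n : ℤ) + 1 / 2 : ℝ) * θ) =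
        Real.cos ((((j : ℤ) : ℝ) + 1 / 2) * θ) := by
      intro θ
      rcases hcases with h | h
      · rw [h]
      · rw [h, ← Real.cos_neg]
        congr 1
        push_cast
        ring
    have hsq : halfIntSq n = (((j : ℤ) : ℝ) + 1 / 2) ^ 2 := by
      change _ = halfIntSq j
      rcases hcases with h | h
      · rw [← h]
      · rw [h, halfIntSq_neg_one_sub]
    refine ⟨?_, ϑ, hϑ, φ, hφ, R, hint, fun θ => ?_, fun θ => (hR θ).trans ?_⟩
    · rw [← hsq]
      exact hlam.trans (hdiv _ hG0)
    · rw [hform θ, hcosj]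
    · refine (hdiv _ (by positivity)).trans_eq ?_
      ring
  choose hlam ϑ hϑ φ hφ R hint hform hR using hmain
  refine ⟨kstar, N + 1,
    fun j => if h : ((N + 1 : ℕ) : ℤ) ≤ |j| then μ (σ ⟨j, h⟩ : ℕ+) else 0, by omega,
    ⟨σ, fun j => dif_pos j.2⟩, ⟨2 * G, fun j hj => ?_⟩,
    fun j => if h : ((N + 1 : ℕ) : ℤ) ≤ |j| then ϑ ⟨j, h⟩ else 0,
    fun j => if h : ((N + 1 : ℕ) : ℤ) ≤ |j| then φ ⟨j, h⟩ else 0,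
    fun j => if h : ((N + 1 : ℕ) : ℤ) ≤ |j| then R ⟨j, h⟩ else 0, fun j hj => ?_,
    4 * K, fun j hj θ _ => ?_⟩
  · simp only [dif_pos hj]
    exact hlam ⟨j, hj⟩
  · simp only [dif_pos hj]
    exact ⟨hϑ _, hφ _, hint _, fun θ _ => hform ⟨j, hj⟩ θ⟩
  · simp only [dif_pos hj]
    exact hR ⟨j, hj⟩ θ
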